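/- Let $G$ be a connected complex simple Lie group of type $ADE$, with Lie algebra $\mathfrak g$, Cartan subalgebra $\mathfrak h$ and set of simple roots $\Delta$. For $\Sigma\subseteq\Delta$ let $P=P(\Sigma)\le G$ be the parabolic subgroup with Lie algebra $\mathfrak p=\mathfrak h\oplus\bigoplus_{\alpha>0}\mathfrak g_\alpha\oplus\bigoplus_{\alpha<0,\ \alpha\in\mathbb Z(\Delta\setminus\Sigma)}\mathfrak g_\alpha$, and write $\mathfrak p=\mathfrak r\oplus\mathfrak n$ with $\mathfrak r=\mathfrak h\oplus\bigoplus_{\alpha\in\mathbb Z(\Delta\setminus\Sigma)}\mathfrak g_\alpha$ reductive and $\mathfrak n=\bigoplus_{\alpha>0,\ \alpha\notin\mathbb Z(\Delta\setminus\Sigma)}\mathfrak g_\alpha$ nilpotent. For a dominant weight $\lambda$ of the reductive part $R$ of $P$ let $E_\lambda$ be the irreducible representation of highest weight $\lambda$. The quiver $\mathcal Q_{G/P}$ has these $\lambda$ as vertices, and an arrow $\lambda\to\mu$ if and only if there is a non-zero $\mathfrak r$-equivariant map $\mathfrak n\otimes E_\lambda\to E_\mu$. Let $E$ be a $G$-homogeneous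 holomorphic vector bundle of rank $r$ on $G/P$. Its fibre at the base point is a $P$-module, which decomposes over $\mathfrak r$ as $\bigoplus_\lambda E_\lambda\otimes V_\lambda$; $E$ is called multiplicity free if $\dim V_\lambda=1$ whenever $V_\lambda\ne 0$. Let $\mathcal Q|_E$ be the support in $\mathcal Q_{G/P}$ of the quiver representation defined by $E$: its vertices are the $\lambda$ with $V_\lambda\neq0$, and its arrows are the arrows $\lambda\to\mu$ between such vertices on which the representation is not zero, i.e. for which the component $\mathfrak n\otimes(E_\lambda\otimes V_\lambda)\to E_\mu\otimes V_\mu$ of the action of $\mathfrak n$ on the fibre is not zero. If $E$ is multiplicity free and $k$ is the number of connected components of $\mathcal Q|_E$, then the space $H^0(G/P,\operatorname{End}E)^{\mathbb C}$ of $G$-invariant endomorphisms of $E$ is isomorphic to $\mathbb C^k$. In particular, if $\mathcal Q|_E$ is connected, then $E$ is weakly simple, i.e. its only $G$-invariant endomorphisms are the scalar multiples of the identity. -/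

import Mathlib

open scoped Manifold ContDiff Bundle TensorProduct

noncomputable section

/-! ### Parabolic subalgebras and representations of parabolic subalgebras -/

namespace HomBundle

open LieAlgebra LieAlgebra.IsKilling Module

section Algebra

variable {𝔤 : Type*} [LieRing 𝔤] [LieAlgebra ℂ 𝔤] [FiniteDimensional ℂ 𝔤] [IsKilling ℂ 𝔤]
  {H : LieSubalgebra ℂ 𝔤} [H.IsCartanSubalgebra]

/-- The root system, with base `b` of simple roots, is of type `A_n` (`n ≥ 1`), `D_n` (`n ≥ 4`),
`E₆`, `E₇` or `E₈`. -/
def IsADE (b : (rootSystem H).Base) : Prop :=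
  (∃ n : ℕ, 1 ≤ n ∧ ∃ e : b.support ≃ Fin n, ∀ i j,
      b.cartanMatrix i j = CartanMatrix.A n (e i) (e j)) ∨
  (∃ n : ℕ, 4 ≤ n ∧ ∃ e : b.support ≃ Fin n, ∀ i j,
      b.cartanMatrix i j = CartanMatrix.D n (e i) (e j)) ∨
  (∃ e : b.support ≃ Fin 6, ∀ i j, b.cartanMatrix i j = CartanMatrix.E₆ (e i) (e j)) ∨
  (∃ e : b.support ≃ Fin 7, ∀ i j, b.cartanMatrix i j = CartanMatrix.E₇ (e i) (e j)) ∨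
  (∃ e : b.support ≃ Fin 8, ∀ i j, b.cartanMatrix i j = CartanMatrix.E₈ (e i) (e j))

/-- Sums of simple roots with coefficients in `ℕ`. The roots in this set are the positive roots. -/
def posCone (b : (rootSystem H).Base) : AddSubmonoid (Dual ℂ H) :=
  AddSubmonoid.closure (Set.range fun i : b.support => (rootSystem H).root i)

/-- The subgroup spanned by the simple roots that do not belong to `S`. The roots that lie in it
are the roots of the reductive part of the parabolic subalgebra attached to `S`. -/
def leviLattice (b : (rootSystem H).Base) (S : Set b.support) : AddSubgroup (Dual ℂ H) :=
  AddSubgroup.closure {χ | ∃ i : b.support, i ∉ S ∧ χ = (rootSystem H).root i}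

/-- The sum of the root spaces `𝔤_χ`, `χ ∈ A`. Here `𝔤_0 = 𝔥`, and `𝔤_χ = 0` if `χ ≠ 0` is not
a root. -/
def rootSum (A : Set (Dual ℂ H)) : LieSubmodule ℂ H 𝔤 :=
  ⨆ χ ∈ A, rootSpace H (χ : H → ℂ)

set_option linter.unusedSectionVars false in
theorem lie_mem_rootSum {A B C : Set (Dual ℂ H)}
    (h : ∀ χ ∈ A, ∀ ψ ∈ B, rootSpace H ((χ + ψ : Dual ℂ H) : H → ℂ) ≠ ⊥ → χ + ψ ∈ C)
    {x y : 𝔤} (hx : x ∈ rootSum A) (hy : y ∈ rootSum B) : ⁅x, y⁆ ∈ rootSum (H := H) C := by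
  unfold rootSum at hx hy
  induction hx using LieSubmodule.iSup_induction' with
  | zero => simp
  | add _ _ _ _ hu hv => rw [add_lie]; exact add_mem hu hv
  | mem χ u hu =>
    by_cases hχ : χ ∈ A
    swap
    · simp_all
    replace hu : u ∈ rootSpace H (χ : H → ℂ) := by simpa [hχ] using hu
    induction hy using LieSubmodule.iSup_induction' with
    | zero => simp
    | add _ _ _ _ hv hw => rw [lie_add]; exact add_mem hv hw
    | mem ψ v hv =>
      by_cases hψ : ψ ∈ B
      swap
      · simp_all
      replace hv : v ∈ rootSpace H (ψ : H → ℂ) := by simpa [hψ] using hv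
      have key : ⁅u, v⁆ ∈ rootSpace H ((χ + ψ : Dual ℂ H) : H → ℂ) :=
        lie_mem_genWeightSpace_of_mem_genWeightSpace hu hv
      by_cases h0 : rootSpace H ((χ + ψ : Dual ℂ H) : H → ℂ) = ⊥
      · rw [h0, LieSubmodule.mem_bot] at key
        rw [key]
        exact zero_mem _
      · exact LieSubmodule.mem_iSup_of_mem (χ + ψ)
          (LieSubmodule.mem_iSup_of_mem (h χ hχ ψ hψ h0) key)

/-- The parabolic subalgebra `𝔭(S) = 𝔥 ⊕ ⨁_{α > 0} 𝔤_α ⊕ ⨁_{α < 0, α ∈ Φ(S)} 𝔤_α`, where `Φ(S)`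
is the set of the roots that are combinations of simple roots outside `S`. -/
def parabolic (b : (rootSystem H).Base) (S : Set b.support) : Submodule ℂ 𝔤 :=
  (rootSum ((posCone b : Set (Dual ℂ H)) ∪ leviLattice b S)).toSubmodule

/-- The reductive part `𝔯 = 𝔥 ⊕ ⨁_{α ∈ Φ(S)} 𝔤_α` of `𝔭(S)`. -/
def levi (b : (rootSystem H).Base) (S : Set b.support) : LieSubalgebra ℂ 𝔤 where
  toSubmodule := (rootSum (leviLattice b S : Set (Dual ℂ H))).toSubmodule
  lie_mem' hx hy := lie_mem_rootSum (fun _ hχ _ hψ _ => add_mem hχ hψ) hx hy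

theorem nilrad_aux (b : (rootSystem H).Base) (S : Set b.support) {χ ψ : Dual ℂ H}
    (hχ : χ ∈ leviLattice b S) (hψ : ψ ∈ (posCone b : Set (Dual ℂ H)) \ leviLattice b S)
    (h : rootSpace H ((χ + ψ : Dual ℂ H) : H → ℂ) ≠ ⊥) :
    χ + ψ ∈ (posCone b : Set (Dual ℂ H)) \ leviLattice b S := by
  classical
  have hnot : χ + ψ ∉ leviLattice b S := fun hm =>
    hψ.2 (by simpa using sub_mem hm hχ)
  -- the sum of the coefficients at the simple roots in `S`
  obtain ⟨f, hf⟩ : ∃ f : Dual ℂ H →ₗ[ℂ] ℂ, ∀ i : b.support,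
      f ((rootSystem H).root i) = if i ∈ S then 1 else 0 := by
    have hli : LinearIndependent ℂ (fun i : b.support => (rootSystem H).root i) :=
      b.linearIndepOn_root
    obtain ⟨f, hf⟩ := ((Basis.span hli).constr ℂ
      (fun i : b.support => if i ∈ S then (1 : ℂ) else 0)).exists_extend
    refine ⟨f, fun i => ?_⟩
    have h1 := LinearMap.congr_fun hf (Basis.span hli i)
    rw [Basis.constr_basis] at h1
    rw [← h1, LinearMap.comp_apply, Submodule.subtype_apply, Basis.span_apply]
  have hlat : ∀ θ ∈ leviLattice b S, f θ = 0 := by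
    intro θ hθ
    induction hθ using AddSubgroup.closure_induction with
    | mem x hx => obtain ⟨i, hi, rfl⟩ := hx; rw [hf, if_neg hi]
    | zero => simp
    | add _ _ _ _ h1 h2 => rw [map_add, h1, h2, add_zero]
    | neg _ _ h1 => rw [map_neg, h1, neg_zero]
  have hpos : ∀ θ ∈ posCone b, ∃ n : ℕ, f θ = n ∧ (n = 0 → θ ∈ leviLattice b S) := by
    intro θ hθ
    induction hθ using AddSubmonoid.closure_induction with
    | mem x hx =>
      obtain ⟨i, rfl⟩ := hx
      by_cases hi : i ∈ S
      · exact ⟨1, by rw [hf, if_pos hi, Nat.cast_one], by simp⟩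
      · exact ⟨0, by rw [hf, if_neg hi, Nat.cast_zero], fun _ => AddSubgroup.subset_closure ⟨i, hi, rfl⟩⟩
    | zero => exact ⟨0, by simp, fun _ => zero_mem _⟩
    | add _ _ _ _ h1 h2 =>
      obtain ⟨m, hm, hm'⟩ := h1
      obtain ⟨n, hn, hn'⟩ := h2
      exact ⟨m + n, by simp [hm, hn], fun h => add_mem (hm' (by omega)) (hn' (by omega))⟩
  refine ⟨?_, hnot⟩
  have hne : (χ + ψ : Dual ℂ H) ≠ 0 := fun h0 => hnot (h0 ▸ zero_mem _)
  let α : LieModule.Weight ℂ H 𝔤 := ⟨((χ + ψ : Dual ℂ H) : H → ℂ), h⟩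
  have hα : α ∈ H.root := by
    simp only [LieSubalgebra.root, Finset.mem_filter, Finset.mem_univ, true_and]
    intro h0
    apply hne
    ext x
    exact congrFun h0 x
  have hroot : (rootSystem H).root ⟨α, hα⟩ = χ + ψ := by
    ext x
    rfl
  have hrange : (rootSystem H).root '' (b.support : Set H.root) =
      Set.range fun i : b.support => (rootSystem H).root i := by
    ext x
    simp
  rcases b.root_mem_or_neg_mem ⟨α, hα⟩ with hp | hn
  · rw [hroot, hrange] at hp
    exact hp
  · exfalso
    rw [hroot, hrange] at hn
    obtain ⟨m, hm, hm'⟩ := hpos _ hn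
    obtain ⟨n, hn1, hn2⟩ := hpos _ hψ.1
    rw [map_neg, map_add, hlat χ hχ, zero_add, hn1] at hm
    have hmn : ((m + n : ℕ) : ℂ) = 0 := by
      push_cast
      rw [← hm]
      ring
    have hz : m + n = 0 := by exact_mod_cast hmn
    exact hψ.2 (hn2 (by omega))

/-- The nilpotent part `𝔫 = ⨁_{α > 0, α ∉ Φ(S)} 𝔤_α` of `𝔭(S)`, as an `𝔯`-module with the adjoint
action. -/
def nilrad (b : (rootSystem H).Base) (S : Set b.support) : LieSubmodule ℂ (levi b S) 𝔤 where
  toSubmodule := (rootSum ((posCone b : Set (Dual ℂ H)) \ leviLattice b S)).toSubmodule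
  lie_mem {x _} hm := lie_mem_rootSum (fun _ hχ _ hψ h => nilrad_aux b S hχ hψ h) x.2 hm

/-- `W` is the irreducible `𝔯`-module `E_lam` of highest weight `lam`. -/
structure IsHighestWeightModule (b : (rootSystem H).Base) (S : Set b.support) (lam : Dual ℂ H)
    (W : Type) [AddCommGroup W] [Module ℂ W] [LieRingModule (levi b S) W]
    [LieModule ℂ (levi b S) W] : Prop where
  finite : FiniteDimensional ℂ W
  irreducible : LieModule.IsIrreducible ℂ (levi b S) W
  exists_highest : ∃ w : W, w ≠ 0 ∧
    (∀ (x : levi b S) (hx : (x : 𝔤) ∈ H), ⁅x, w⁆ = lam ⟨x, hx⟩ • w) ∧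
    (∀ χ ∈ posCone b, χ ∈ leviLattice b S → χ ≠ 0 → ∀ x : levi b S,
      (x : 𝔤) ∈ rootSpace H (χ : H → ℂ) → ⁅x, w⁆ = 0)

/-- `Hom(𝔫 ⊗ E_lam, E_mu)` contains a non-zero `𝔯`-equivariant map. -/
def HasArrow (b : (rootSystem H).Base) (S : Set b.support) (lam mu : Dual ℂ H) : Prop :=
  ∃ (W W' : Type) (_ : AddCommGroup W) (_ : Module ℂ W) (_ : LieRingModule (levi b S) W)
    (_ : LieModule ℂ (levi b S) W) (_ : AddCommGroup W') (_ : Module ℂ W')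
    (_ : LieRingModule (levi b S) W') (_ : LieModule ℂ (levi b S) W'),
    IsHighestWeightModule b S lam W ∧ IsHighestWeightModule b S mu W' ∧
    ∃ f : (nilrad b S) ⊗[ℂ] W →ₗ⁅ℂ, levi b S⁆ W', f ≠ 0

variable {b : (rootSystem H).Base} {S : Set b.support}
  {V : Type*} [AddCommGroup V] [Module ℂ V] (τ : parabolic b S →ₗ[ℂ] Module.End ℂ V)

/-! In the following definitions, `τ` is the action of `𝔭(S)` on a `𝔭(S)`-module `V`. -/

/-- The space of highest weight vectors (and `0`) of weight `lam` for `𝔯` in `V`: the vectors of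
weight `lam` under `𝔥` that are killed by the positive root spaces of `𝔯`. It is the multiplicity
space `V_lam = Hom_𝔯(E_lam, V)` of `E_lam` in the `𝔯`-module `V`. -/
def multiplicitySpace (lam : Dual ℂ H) : Submodule ℂ V where
  carrier := {v | (∀ (x : parabolic b S) (hx : (x : 𝔤) ∈ H), τ x v = lam ⟨x, hx⟩ • v) ∧
    (∀ χ ∈ posCone b, χ ∈ leviLattice b S → χ ≠ 0 → ∀ x : parabolic b S,
      (x : 𝔤) ∈ rootSpace H (χ : H → ℂ) → τ x v = 0)}
  add_mem' hu hv := ⟨fun x hx => by rw [map_add, hu.1 x hx, hv.1 x hx, smul_add],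
    fun χ h1 h2 h3 x hx => by rw [map_add, hu.2 χ h1 h2 h3 x hx, hv.2 χ h1 h2 h3 x hx, add_zero]⟩
  zero_mem' := ⟨fun x hx => by simp, fun χ _ _ _ x _ => by simp⟩
  smul_mem' c v hv := ⟨fun x hx => by rw [map_smul, hv.1 x hx, smul_comm],
    fun χ h1 h2 h3 x hx => by rw [map_smul, hv.2 χ h1 h2 h3 x hx, smul_zero]⟩

/-- `W` is an `𝔯`-submodule of `V`. -/
def IsLeviStable (W : Submodule ℂ V) : Prop :=
  ∀ x : parabolic b S, (x : 𝔤) ∈ levi b S → ∀ w ∈ W, τ x w ∈ W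

/-- `W` is an irreducible `𝔯`-submodule of `V` of highest weight `lam`. -/
structure IsIrredOfWeight (lam : Dual ℂ H) (W : Submodule ℂ V) : Prop where
  stable : IsLeviStable τ W
  ne_bot : W ≠ ⊥
  irreducible : ∀ W' ≤ W, IsLeviStable τ W' → W' = ⊥ ∨ W' = W
  exists_highest : ∃ w ∈ W, w ≠ 0 ∧ w ∈ multiplicitySpace τ lam

/-- The isotypic component `E_lam ⊗ V_lam` of the `𝔯`-module `V`. -/
def isotypic (lam : Dual ℂ H) : Submodule ℂ V :=
  sSup {W | IsIrredOfWeight τ lam W}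

/-- `V` is multiplicity free: as an `𝔯`-module it is the direct sum of irreducible modules
`E_{lam 1}, …, E_{lam n}` with pairwise distinct highest weights. -/
def IsMultiplicityFreeRep : Prop :=
  ∃ (n : ℕ) (lam : Fin n → Dual ℂ H) (W : Fin n → Submodule ℂ V), Function.Injective lam ∧
    (∀ i, IsIrredOfWeight τ (lam i) (W i)) ∧ DirectSum.IsInternal W

/-- The component `𝔫 ⊗ (E_lam ⊗ V_lam) → E_mu ⊗ V_mu` of the action `𝔫 ⊗ V → V` is not zero.
Equivalently, the map `V_lam → V_mu` that the quiver representation of `V` puts on the arrow from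
`lam` to `mu` is not zero. -/
def ArrowNonzero (lam mu : Dual ℂ H) : Prop :=
  ∃ x : parabolic b S, (x : 𝔤) ∈ nilrad b S ∧ ∃ v ∈ isotypic τ lam,
    τ x v ∉ ⨆ ν : {ν : Dual ℂ H // ν ≠ mu}, isotypic τ ν.1

end Algebra

/-! ### Complex Lie groups, parabolic subgroups and their representations -/

/-- The Hermitian space `ℂ^d`, as the model of complex manifolds of dimension `d` and of fibres of
vector bundles of rank `d`. -/
abbrev Cn (d : ℕ) := EuclideanSpace ℂ (Fin d)

/-- The Lie algebra of a complex Lie group of dimension `d`. -/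
abbrev LieAlg (d : ℕ) (G : Type*) [TopologicalSpace G] [ChartedSpace (Cn d) G] [Group G] :=
  GroupLieAlgebra 𝓘(ℂ, Cn d) G

instance (d : ℕ) (G : Type*) [TopologicalSpace G] [ChartedSpace (Cn d) G] [Group G] :
    FiniteDimensional ℂ (LieAlg d G) :=
  inferInstanceAs (FiniteDimensional ℂ (Cn d))

section Group

variable {d e : ℕ} {G : Type*} [TopologicalSpace G] [ChartedSpace (Cn d) G] [Group G]
  [LieGroup 𝓘(ℂ, Cn d) ω G] [LieAlgebra.IsSimple ℂ (LieAlg d G)]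
  {H : LieSubalgebra ℂ (LieAlg d G)} [H.IsCartanSubalgebra]
  (b : (rootSystem H).Base) (S : Set b.support)
  (P : Subgroup G) [ChartedSpace (Cn e) P]

/-- The differential at `1` of the inclusion of `P` in `G`. -/
def inclDeriv : LieAlg e P →ₗ[ℂ] LieAlg d G :=
  (mfderiv 𝓘(ℂ, Cn e) 𝓘(ℂ, Cn d) (P.subtype : P → G) 1).toLinearMap

/-- `P` is the parabolic subgroup `P(S)` of `G`: the closed connected complex Lie subgroup with
Lie algebra `𝔭(S)`. -/
structure IsParabolic : Prop where
  closed : IsClosed (P : Set G)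
  connected : ConnectedSpace P
  holomorphic : ContMDiff 𝓘(ℂ, Cn e) 𝓘(ℂ, Cn d) ω (P.subtype : P → G)
  immersion : Function.Injective (inclDeriv (d := d) (e := e) P)
  lieAlgebra : LinearMap.range (inclDeriv (d := d) (e := e) P) = parabolic b S

variable {b S P}

/-- A finite-dimensional representation `ρ` of `P` on `ℂ^r`, differentiated at `1`. -/
def repDeriv {r : ℕ} (ρ : P →* (Cn r →L[ℂ] Cn r)) : LieAlg e P →ₗ[ℂ] (Cn r →L[ℂ] Cn r) :=
  (mfderiv 𝓘(ℂ, Cn e) 𝓘(ℂ, Cn r →L[ℂ] Cn r) ρ 1).toLinearMap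

/-- The action of `𝔭(S) = Lie P` on a representation of `P`. -/
def lieAct (hP : IsParabolic (e := e) b S P) {r : ℕ} (ρ : P →* (Cn r →L[ℂ] Cn r)) :
    parabolic b S →ₗ[ℂ] Module.End ℂ (Cn r) :=
  (ContinuousLinearMap.coeLM ℂ) ∘ₗ (repDeriv (e := e) ρ) ∘ₗ
    ((LinearEquiv.ofInjective (inclDeriv (d := d) (e := e) P) hP.immersion).trans
      (LinearEquiv.ofEq _ _ hP.lieAlgebra)).symm.toLinearMap

/-- The dominant weights of the reductive part `R` of `P`: the highest weights `lam` of the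
irreducible constituents, for the reductive part, of the finite-dimensional holomorphic
representations of `P`. -/
def IsDominantWeight (hP : IsParabolic (e := e) b S P) (lam : Dual ℂ H) : Prop :=
  ∃ (r : ℕ) (ρ : P →* (Cn r →L[ℂ] Cn r)) (W : Submodule ℂ (Cn r)),
    ContMDiff 𝓘(ℂ, Cn e) 𝓘(ℂ, Cn r →L[ℂ] Cn r) ω ρ ∧ IsIrredOfWeight (lieAct hP ρ) lam W

/-- The vertices of the quiver of `G/P`: the dominant weights of the reductive part of `P`. -/
def QuiverVertex (hP : IsParabolic (e := e) b S P) : Type _ :=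
  {lam : Dual ℂ H // IsDominantWeight hP lam}

/-- The quiver of `G/P`: there is an arrow `lam → mu` if and only if there is a non-zero
`𝔯`-equivariant map `𝔫 ⊗ E_lam → E_mu`. -/
instance (hP : IsParabolic (e := e) b S P) : Quiver (QuiverVertex hP) where
  Hom lam mu := PLift (HasArrow b S lam.1 mu.1)

/-- The vertices `lam` of the quiver of `G/P` at which the quiver representation attached to the
representation `ρ` of `P` is not zero, i.e. `V_lam ≠ 0`. -/
def SupportVertex (hP : IsParabolic (e := e) b S P) {r : ℕ} (ρ : P →* (Cn r →L[ℂ] Cn r)) : Type _ :=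
  {lam : QuiverVertex hP // multiplicitySpace (lieAct hP ρ) lam.1 ≠ ⊥}

/-- The support of the quiver representation attached to `ρ`, as a subquiver of the quiver of
`G/P`: the arrows between vertices of the support on which the representation is not zero. -/
instance (hP : IsParabolic (e := e) b S P) {r : ℕ} (ρ : P →* (Cn r →L[ℂ] Cn r)) :
    Quiver (SupportVertex hP ρ) where
  Hom lam mu := {_a : lam.1 ⟶ mu.1 // ArrowNonzero (lieAct hP ρ) lam.1.1 mu.1.1}

end Group

/-! ### Homogeneous vector bundles -/

section Bundle

variable {d e m r : ℕ} {G : Type*} [TopologicalSpace G] [ChartedSpace (Cn d) G] [Group G]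
  {P : Subgroup G} [ChartedSpace (Cn m) (G ⧸ P)]
  (E : G ⧸ P → Type*) [TopologicalSpace (Bundle.TotalSpace (Cn r) E)]
  [∀ x, AddCommGroup (E x)] [∀ x, Module ℂ (E x)] [∀ x, TopologicalSpace (E x)]
  [FiberBundle (Cn r) E] [VectorBundle ℂ (Cn r) E]

/-- A homogeneous structure on a holomorphic vector bundle `E` of rank `r` on `G/P`: a
holomorphic action of `G` on the total space that lifts the action of `G` on `G/P` and is linear
on the fibres. -/
structure HomogeneousStructure (d m r : ℕ) {G : Type*} [TopologicalSpace G] [ChartedSpace (Cn d) G]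
    [Group G] {P : Subgroup G} [ChartedSpace (Cn m) (G ⧸ P)]
    (E : G ⧸ P → Type*) [TopologicalSpace (Bundle.TotalSpace (Cn r) E)]
    [∀ x, AddCommGroup (E x)] [∀ x, Module ℂ (E x)] [∀ x, TopologicalSpace (E x)]
    [FiberBundle (Cn r) E] [VectorBundle ℂ (Cn r) E] where
  act : ∀ (g : G) (x : G ⧸ P), E x →ₗ[ℂ] E (g • x)
  one_act : ∀ (x : G ⧸ P) (v : E x),
    (⟨(1 : G) • x, act 1 x v⟩ : Bundle.TotalSpace (Cn r) E) = ⟨x, v⟩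
  mul_act : ∀ (g h : G) (x : G ⧸ P) (v : E x),
    (⟨(g * h) • x, act (g * h) x v⟩ : Bundle.TotalSpace (Cn r) E) =
      ⟨g • h • x, act g (h • x) (act h x v)⟩
  holomorphic : ContMDiff (𝓘(ℂ, Cn d).prod (𝓘(ℂ, Cn m).prod 𝓘(ℂ, Cn r)))
    (𝓘(ℂ, Cn m).prod 𝓘(ℂ, Cn r)) ω
    (fun p : G × Bundle.TotalSpace (Cn r) E =>
      (⟨p.1 • p.2.1, act p.1 p.2.1 p.2.2⟩ : Bundle.TotalSpace (Cn r) E))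

variable {E}

/-- The transport of the fibre along an equality of points. -/
def fibreCast {x y : G ⧸ P} (h : x = y) : E x →ₗ[ℂ] E y := by
  subst h
  exact LinearMap.id

set_option linter.unusedSectionVars false in
theorem mk_fibreCast {x y : G ⧸ P} (h : x = y) (v : E x) :
    (⟨y, fibreCast h v⟩ : Bundle.TotalSpace (Cn r) E) = ⟨x, v⟩ := by
  subst h
  rfl

set_option linter.unusedSectionVars false in
theorem smul_base (p : P) : (p : G) • ((1 : G) : G ⧸ P) = ((1 : G) : G ⧸ P) := by
  rw [MulAction.Quotient.smul_coe, smul_eq_mul, mul_one, QuotientGroup.eq]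
  simp

namespace HomogeneousStructure

variable (A : HomogeneousStructure d m r E)

/-- The action of `p ∈ P` on the fibre at the base point `o = P` of `G/P`. -/
def isotropyMap (p : P) : E ((1 : G) : G ⧸ P) →ₗ[ℂ] E ((1 : G) : G ⧸ P) :=
  fibreCast (smul_base p) ∘ₗ A.act p _

theorem mk_isotropyMap (p : P) (v : E ((1 : G) : G ⧸ P)) :
    (⟨((1 : G) : G ⧸ P), A.isotropyMap p v⟩ : Bundle.TotalSpace (Cn r) E) =
      ⟨(p : G) • ((1 : G) : G ⧸ P), A.act p _ v⟩ :=
  mk_fibreCast (smul_base p) _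

theorem mk_act_congr (g : G) {x y : G ⧸ P} {v : E x} {w : E y}
    (h : (⟨x, v⟩ : Bundle.TotalSpace (Cn r) E) = ⟨y, w⟩) :
    (⟨g • x, A.act g x v⟩ : Bundle.TotalSpace (Cn r) E) = ⟨g • y, A.act g y w⟩ := by
  cases h
  rfl

/-- The representation of `P` on the fibre of `E` at the base point. -/
def isotropyRep : P →* Module.End ℂ (E ((1 : G) : G ⧸ P)) where
  toFun := A.isotropyMap
  map_one' := by
    ext v
    apply (Bundle.TotalSpace.mk_inj (F := Cn r)).mp
    exact (A.mk_isotropyMap 1 v).trans (A.one_act _ v)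
  map_mul' p q := by
    ext v
    apply (Bundle.TotalSpace.mk_inj (F := Cn r)).mp
    exact (A.mk_isotropyMap (p * q) v).trans ((A.mul_act p q _ v).trans
      ((A.mk_act_congr p (A.mk_isotropyMap q v)).symm.trans
        (A.mk_isotropyMap p (A.isotropyMap q v)).symm))

/-- The identification of the fibre at the base point with `ℂ^r`. -/
def fibreEquiv (E : G ⧸ P → Type*) [TopologicalSpace (Bundle.TotalSpace (Cn r) E)]
  [∀ x, AddCommGroup (E x)] [∀ x, Module ℂ (E x)] [∀ x, TopologicalSpace (E x)]
  [FiberBundle (Cn r) E] [VectorBundle ℂ (Cn r) E] :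
    E ((1 : G) : G ⧸ P) ≃ₗ[ℂ] Cn r :=
  ((trivializationAt (Cn r) E ((1 : G) : G ⧸ P)).continuousLinearEquivAt ℂ _
    (FiberBundle.mem_baseSet_trivializationAt' _)).toLinearEquiv

/-- The representation of `P` on the fibre of `E` at the base point, read in `ℂ^r`. -/
def rep : P →* (Cn r →L[ℂ] Cn r) where
  toFun p := LinearMap.toContinuousLinearMap ((fibreEquiv E).conj (A.isotropyRep p))
  map_one' := by
    ext v : 1
    simp [LinearEquiv.conj_apply]
  map_mul' p q := by
    ext v : 1
    simp [LinearEquiv.conj_apply]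

section Endomorphisms

variable [∀ x, IsTopologicalAddGroup (E x)] [∀ x, ContinuousSMul ℂ (E x)]

/-- `H⁰(End E)^G`: the holomorphic sections `s` of the bundle `End E` that are invariant under
`G`, i.e. such that `s (g x) ∘ g = g ∘ s x` on each fibre. -/
def invariantEnd : Submodule ℂ
    (ContMDiffSection 𝓘(ℂ, Cn m) (Cn r →L[ℂ] Cn r) ω (fun x : G ⧸ P => E x →L[ℂ] E x)) where
  carrier := {s | ∀ (g : G) (x : G ⧸ P) (v : E x), s (g • x) (A.act g x v) = A.act g x (s x v)}
  add_mem' hs ht g x v := by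
    simp only [ContMDiffSection.coe_add, Pi.add_apply, add_apply, map_add]
    rw [hs g x v, ht g x v]
  zero_mem' g x v := by
    simp only [ContMDiffSection.coe_zero, Pi.zero_apply, zero_apply, map_zero]
  smul_mem' c s hs g x v := by
    simp only [ContMDiffSection.coe_smul, Pi.smul_apply, smul_apply, map_smul]
    rw [hs g x v]

/-- `E` is weakly simple: its only `G`-invariant endomorphisms are the multiples of the
identity. -/
def IsWeaklySimple : Prop :=
  ∀ s ∈ A.invariantEnd, ∃ c : ℂ, ∀ (x : G ⧸ P) (v : E x), s x v = c • v

end Endomorphisms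

end HomogeneousStructure

end Bundle

end HomBundle

end

noncomputable section

namespace HomBundle

/-! ### Lie brackets of vector fields as commutators of derivations. -/

section

open VectorField Filter Topology

section LieBracket

variable {𝕜 : Type*} [RCLike 𝕜] {E F : Type*} [NormedAddCommGroup E] [NormedSpace 𝕜 E]
  [CompleteSpace E] [NormedAddCommGroup F] [NormedSpace 𝕜 F]
  {M : Type*} [TopologicalSpace M] [ChartedSpace E M] [IsManifold 𝓘(𝕜, E) ω M]

/-! The proof reduces invariant endomorphisms of `E` to linear algebra on the fibre at the base
point, and then applies a form of Schur's lemma.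

Evaluation at the base point identifies invariant sections of `End E` with the endomorphisms of the
fibre that commute with `P` (`invariantEndEquiv`). It is injective because `G` is transitive on `G ⧸
P`. It is surjective because an endomorphism commuting with `P` can be transported to every fibre
independently of the coset representative, and the result is holomorphic because `G → G ⧸ P`, a
submersion, has local holomorphic sections. As `P` is connected, commuting with `P` is the same as
commuting with the derived action of `𝔭` (`mem_commutant_lieAct_iff`). That this action respects
brackets (`isLieRep_lieAct`) rests on brackets of left-invariant fields being commutators of
derivations.

Write the fibre as a sum of irreducible `𝔯`-modules `W i` with distinct highest weights. An
irreducible `𝔯`-module has only one highest weight line (`mem_span_of_highest`): it is generated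
from a highest weight vector by lowering operators, which strictly decrease the height. Hence the
isotypic components are exactly the `W i`, and an endomorphism commuting with `𝔯` is a scalar `c i`
on each `W i` (`exists_scalars`). Since `𝔭 = 𝔯 + 𝔫`, such an endomorphism commutes with `𝔭` if and
only if `c i = c j` whenever `𝔫` has a non-zero component from `W i` to `W j`
(`constantAlongEquivCommutant`). Such a component is itself an equivariant map from `𝔫 ⊗ W i` to `W
j`, so these pairs are precisely the arrows of the support. The admissible `c` are therefore the
functions on its set of connected components. If there is one component, the commutant is a line; it
contains the identity, so all invariant endomorphisms are scalars. -/

omit [CompleteSpace E] [IsManifold 𝓘(𝕜, E) ω M] in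
theorem _root_.ContMDiffAt.contDiffAt_comp_extChartAt_symm {n : ℕ∞ω} {f : M → F} {x₀ : M}
    (hf : ContMDiffAt 𝓘(𝕜, E) 𝓘(𝕜, F) n f x₀) :
    ContDiffAt 𝕜 n (f ∘ (extChartAt 𝓘(𝕜, E) x₀).symm) (extChartAt 𝓘(𝕜, E) x₀ x₀) := by
  have := (contMDiffAt_iff.mp hf).2
  simpa [Function.comp_def, contDiffWithinAt_univ, chartAt_self_eq] using this

-- The pullback of `V` to the chart contains the inverse of the derivative of the inverse chart,
-- which cancels in the chain rule. The derivation along `V` thus becomes an ordinary derivative in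
-- a vector space.
omit [CompleteSpace E] in
theorem fderiv_comp_extChartAt_symm_mpullback {f : M → F} {x₀ : M}
    (hf : ContMDiffAt 𝓘(𝕜, E) 𝓘(𝕜, F) 2 f x₀) (V : Π x : M, TangentSpace 𝓘(𝕜, E) x) {a : M → F}
    (ha : ∀ᶠ x in 𝓝 x₀, mfderiv 𝓘(𝕜, E) 𝓘(𝕜, F) f x (V x) = a x) :
    (fun y : E => fderiv 𝕜 (f ∘ (extChartAt 𝓘(𝕜, E) x₀).symm) y
      (mpullbackWithin 𝓘(𝕜, E) 𝓘(𝕜, E) (extChartAt 𝓘(𝕜, E) x₀).symm V Set.univ y : E))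
      =ᶠ[𝓝 (extChartAt 𝓘(𝕜, E) x₀ x₀)] a ∘ (extChartAt 𝓘(𝕜, E) x₀).symm := by
  have hf' : ∀ᶠ x in 𝓝 x₀, MDifferentiableAt 𝓘(𝕜, E) 𝓘(𝕜, F) f x :=
    ((contMDiffAt_iff_contMDiffAt_nhds (by simp)).mp hf).mono
      fun x hx => hx.mdifferentiableAt (by simp)
  have hc := continuousAt_extChartAt_symm (I := 𝓘(𝕜, E)) x₀
  have hx : (extChartAt 𝓘(𝕜, E) x₀).symm (extChartAt 𝓘(𝕜, E) x₀ x₀) = x₀ := by simp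
  rw [ContinuousAt, hx] at hc
  filter_upwards [hc.eventually hf', hc.eventually ha,
    extChartAt_target_mem_nhds (I := 𝓘(𝕜, E)) x₀] with y h1 h2 h3
  have hinv := isInvertible_mfderivWithin_extChartAt_symm (I := 𝓘(𝕜, E)) h3
  simp only [modelWithCornersSelf_coe, Set.range_id, mfderivWithin_univ] at hinv
  have hs : MDifferentiableAt 𝓘(𝕜, E) 𝓘(𝕜, E) (extChartAt 𝓘(𝕜, E) x₀).symm y :=
    mdifferentiableAt_of_isInvertible_mfderiv hinv
  have hcomp := mfderiv_comp y h1 hs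
  rw [mfderiv_eq_fderiv] at hcomp
  rw [hcomp, mpullbackWithin_apply, mfderivWithin_univ]
  simp only [Function.comp_apply]
  rw [← h2]
  refine congrArg (mfderiv 𝓘(𝕜, E) 𝓘(𝕜, F) f ((extChartAt 𝓘(𝕜, E) x₀).symm y)) ?_
  exact hinv.self_apply_inverse _

/-- The derivative along a vector field of a vector valued function. -/
theorem mdifferentiableAt_mfderiv_apply {f : M → F} {x₀ : M}
    (hf : ContMDiffAt 𝓘(𝕜, E) 𝓘(𝕜, F) 2 f x₀) {V : Π x : M, TangentSpace 𝓘(𝕜, E) x} {a : M → F}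
    (hV : MDifferentiableAt 𝓘(𝕜, E) 𝓘(𝕜, E).tangent
      (fun x => (⟨x, V x⟩ : TangentBundle 𝓘(𝕜, E) M)) x₀)
    (ha : ∀ᶠ x in 𝓝 x₀, mfderiv 𝓘(𝕜, E) 𝓘(𝕜, F) f x (V x) = a x) :
    MDifferentiableAt 𝓘(𝕜, E) 𝓘(𝕜, F) a x₀ := by
  have : IsManifold 𝓘(𝕜, E) 2 M := IsManifold.of_le (n := ω) le_top
  have key := fderiv_comp_extChartAt_symm_mpullback hf V ha
  have hg : ContDiffAt 𝕜 2 (f ∘ (extChartAt 𝓘(𝕜, E) x₀).symm) (extChartAt 𝓘(𝕜, E) x₀ x₀) :=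
    hf.contDiffAt_comp_extChartAt_symm
  have hV' :=
    (mdifferentiableWithinAt_univ.mpr hV).differentiableWithinAt_mpullbackWithin_vectorField
  simp only [Set.preimage_univ, modelWithCornersSelf_coe, Set.range_id, Set.inter_self] at hV'
  have hV'' : DifferentiableAt 𝕜 (fun y : E => (mpullbackWithin 𝓘(𝕜, E) 𝓘(𝕜, E)
      (extChartAt 𝓘(𝕜, E) x₀).symm V Set.univ y : E)) (extChartAt 𝓘(𝕜, E) x₀ x₀) :=
    differentiableWithinAt_univ.mp hV'
  have hd : DifferentiableAt 𝕜 (a ∘ (extChartAt 𝓘(𝕜, E) x₀).symm) (extChartAt 𝓘(𝕜, E) x₀ x₀) := by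
    refine DifferentiableAt.congr_of_eventuallyEq ?_ key.symm
    exact ((hg.fderiv_right (m := 1) (by norm_num)).differentiableAt (by simp)).clm_apply hV''
  have : MDifferentiableAt 𝓘(𝕜, E) 𝓘(𝕜, F)
      ((a ∘ (extChartAt 𝓘(𝕜, E) x₀).symm) ∘ extChartAt 𝓘(𝕜, E) x₀) x₀ :=
    hd.mdifferentiableAt.comp x₀ (mdifferentiableAt_extChartAt (ChartedSpace.mem_chart_source x₀))
  refine this.congr_of_eventuallyEq ?_
  filter_upwards [extChartAt_source_mem_nhds (I := 𝓘(𝕜, E)) x₀] with x hx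
  simp only [Function.comp_apply]
  rw [(extChartAt 𝓘(𝕜, E) x₀).left_inv hx]

omit [CompleteSpace E] in
theorem fderiv_comp_extChartAt_symm_apply {a : M → F} {x₀ : M}
    (ha : MDifferentiableAt 𝓘(𝕜, E) 𝓘(𝕜, F) a x₀) (v : TangentSpace 𝓘(𝕜, E) x₀) :
    fderiv 𝕜 (a ∘ (extChartAt 𝓘(𝕜, E) x₀).symm) (extChartAt 𝓘(𝕜, E) x₀ x₀)
      (mfderiv 𝓘(𝕜, E) 𝓘(𝕜, E) (extChartAt 𝓘(𝕜, E) x₀) x₀ v) =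
      mfderiv 𝓘(𝕜, E) 𝓘(𝕜, F) a x₀ v := by
  have : IsManifold 𝓘(𝕜, E) 1 M := IsManifold.of_le (n := ω) le_top
  have hx : (extChartAt 𝓘(𝕜, E) x₀).symm (extChartAt 𝓘(𝕜, E) x₀ x₀) = x₀ := by simp
  have hφ : MDifferentiableAt 𝓘(𝕜, E) 𝓘(𝕜, E) (extChartAt 𝓘(𝕜, E) x₀) x₀ :=
    mdifferentiableAt_extChartAt (ChartedSpace.mem_chart_source x₀)
  have hs : MDifferentiableAt 𝓘(𝕜, E) 𝓘(𝕜, E) (extChartAt 𝓘(𝕜, E) x₀).symm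
      (extChartAt 𝓘(𝕜, E) x₀ x₀) := by
    have hinv := isInvertible_mfderivWithin_extChartAt_symm (I := 𝓘(𝕜, E))
      (mem_extChartAt_target (I := 𝓘(𝕜, E)) x₀)
    simp only [modelWithCornersSelf_coe, Set.range_id, mfderivWithin_univ] at hinv
    exact mdifferentiableAt_of_isInvertible_mfderiv hinv
  have hd : MDifferentiableAt 𝓘(𝕜, E) 𝓘(𝕜, F) (a ∘ (extChartAt 𝓘(𝕜, E) x₀).symm)
      (extChartAt 𝓘(𝕜, E) x₀ x₀) := by
    refine MDifferentiableAt.comp _ ?_ hs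
    rw [hx]
    exact ha
  have h1 := mfderiv_comp x₀ hd hφ
  have h2 : mfderiv 𝓘(𝕜, E) 𝓘(𝕜, F) ((a ∘ (extChartAt 𝓘(𝕜, E) x₀).symm) ∘
      extChartAt 𝓘(𝕜, E) x₀) x₀ = mfderiv 𝓘(𝕜, E) 𝓘(𝕜, F) a x₀ := by
    refine Filter.EventuallyEq.mfderiv_eq ?_
    filter_upwards [extChartAt_source_mem_nhds (I := 𝓘(𝕜, E)) x₀] with x hx
    simp only [Function.comp_apply]
    rw [(extChartAt 𝓘(𝕜, E) x₀).left_inv hx]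
  rw [h2, mfderiv_eq_fderiv] at h1
  rw [h1]
  rfl

/-- A Lie bracket of vector fields acts on vector valued functions as the commutator of the
derivations. -/
theorem mfderiv_apply_mlieBracket {f : M → F} {x₀ : M}
    (hf : ContMDiffAt 𝓘(𝕜, E) 𝓘(𝕜, F) 2 f x₀) {V W : Π x : M, TangentSpace 𝓘(𝕜, E) x} {a b : M → F}
    (hV : MDifferentiableAt 𝓘(𝕜, E) 𝓘(𝕜, E).tangent
      (fun x => (⟨x, V x⟩ : TangentBundle 𝓘(𝕜, E) M)) x₀)
    (hW : MDifferentiableAt 𝓘(𝕜, E) 𝓘(𝕜, E).tangent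
      (fun x => (⟨x, W x⟩ : TangentBundle 𝓘(𝕜, E) M)) x₀)
    (ha : ∀ᶠ x in 𝓝 x₀, mfderiv 𝓘(𝕜, E) 𝓘(𝕜, F) f x (V x) = a x)
    (hb : ∀ᶠ x in 𝓝 x₀, mfderiv 𝓘(𝕜, E) 𝓘(𝕜, F) f x (W x) = b x)
    {u v : F} (hu : mfderiv 𝓘(𝕜, E) 𝓘(𝕜, F) b x₀ (V x₀) = u)
    (hv : mfderiv 𝓘(𝕜, E) 𝓘(𝕜, F) a x₀ (W x₀) = v) :
    mfderiv 𝓘(𝕜, E) 𝓘(𝕜, F) f x₀ (mlieBracket 𝓘(𝕜, E) V W x₀) = u - v := by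
  have : IsManifold 𝓘(𝕜, E) 2 M := IsManifold.of_le (n := ω) le_top
  have : IsManifold 𝓘(𝕜, E) 1 M := IsManifold.of_le (n := ω) le_top
  have hg : ContDiffAt 𝕜 2 (f ∘ (extChartAt 𝓘(𝕜, E) x₀).symm) (extChartAt 𝓘(𝕜, E) x₀ x₀) :=
    hf.contDiffAt_comp_extChartAt_symm
  have hV' :=
    (mdifferentiableWithinAt_univ.mpr hV).differentiableWithinAt_mpullbackWithin_vectorField
  have hW' :=
    (mdifferentiableWithinAt_univ.mpr hW).differentiableWithinAt_mpullbackWithin_vectorField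
  simp only [Set.preimage_univ, modelWithCornersSelf_coe, Set.range_id, Set.inter_self] at hV' hW'
  -- At the centre of the chart, pulling back by the inverse chart is pushing forward by the
  -- derivative of the chart.
  have hval : ∀ U : Π x : M, TangentSpace 𝓘(𝕜, E) x,
      (mpullbackWithin 𝓘(𝕜, E) 𝓘(𝕜, E) (extChartAt 𝓘(𝕜, E) x₀).symm U Set.univ
        (extChartAt 𝓘(𝕜, E) x₀ x₀) : E) =
      mfderiv 𝓘(𝕜, E) 𝓘(𝕜, E) (extChartAt 𝓘(𝕜, E) x₀) x₀ (U x₀) := by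
    intro U
    have h1 := (eventuallyEq_mpullback_mpullbackWithin_extChartAt (I := 𝓘(𝕜, E)) (s := Set.univ)
      (x := x₀) U).self_of_nhdsWithin (Set.mem_univ _)
    simp only [modelWithCornersSelf_coe, Set.range_id] at h1
    rw [h1, mpullback_apply]
    exact ((isInvertible_mfderiv_extChartAt (I := 𝓘(𝕜, E))
      (mem_extChartAt_source (I := 𝓘(𝕜, E)) x₀)).self_apply_inverse _).symm
  have hV'' : DifferentiableAt 𝕜 (fun y : E => (mpullbackWithin 𝓘(𝕜, E) 𝓘(𝕜, E)
      (extChartAt 𝓘(𝕜, E) x₀).symm V Set.univ y : E)) (extChartAt 𝓘(𝕜, E) x₀ x₀) :=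
    differentiableWithinAt_univ.mp hV'
  have hW'' : DifferentiableAt 𝕜 (fun y : E => (mpullbackWithin 𝓘(𝕜, E) 𝓘(𝕜, E)
      (extChartAt 𝓘(𝕜, E) x₀).symm W Set.univ y : E)) (extChartAt 𝓘(𝕜, E) x₀ x₀) :=
    differentiableWithinAt_univ.mp hW'
  -- This is the commutator formula in a vector space, for the function and the fields read in the
  -- chart; the rest translates each term back to the manifold.
  have hl := fderiv_apply_lieBracket (n := 2) hg (by simp) hW'' hV''
  rw [(fderiv_comp_extChartAt_symm_mpullback hf V ha).fderiv_eq,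
    (fderiv_comp_extChartAt_symm_mpullback hf W hb).fderiv_eq, hval, hval,
    fderiv_comp_extChartAt_symm_apply (mdifferentiableAt_mfderiv_apply hf hV ha),
    fderiv_comp_extChartAt_symm_apply (mdifferentiableAt_mfderiv_apply hf hW hb), hu, hv] at hl
  rw [← hl, ← fderiv_comp_extChartAt_symm_apply (hf.mdifferentiableAt (by simp)),
    ← mlieBracketWithin_univ, mlieBracketWithin_apply]
  simp only [Set.preimage_univ, modelWithCornersSelf_coe, Set.range_id, Set.inter_self]
  refine congrArg (fderiv 𝕜 (f ∘ (extChartAt 𝓘(𝕜, E) x₀).symm) (extChartAt 𝓘(𝕜, E) x₀ x₀)) ?_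
  exact ((isInvertible_mfderiv_extChartAt (I := 𝓘(𝕜, E))
    (mem_extChartAt_source (I := 𝓘(𝕜, E)) x₀)).self_apply_inverse _).trans
      (congrFun (lieBracketWithin_univ (𝕜 := 𝕜) (E := E)) _)

end LieBracket

/-! ### Derivatives of homomorphisms and representations of Lie groups. -/

section LieGroupHom

variable {𝕜 : Type*} [RCLike 𝕜] {E E' : Type*} [NormedAddCommGroup E] [NormedSpace 𝕜 E]
  [CompleteSpace E] [NormedAddCommGroup E'] [NormedSpace 𝕜 E'] [CompleteSpace E']
  {K : Type*} [TopologicalSpace K] [ChartedSpace E K] [Group K] [LieGroup 𝓘(𝕜, E) ω K]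
  {G : Type*} [TopologicalSpace G] [ChartedSpace E' G] [Group G] [LieGroup 𝓘(𝕜, E') ω G]

omit [CompleteSpace E] [LieGroup 𝓘(𝕜, E) ω K] in
theorem mulInvariantVectorField_one (v : GroupLieAlgebra 𝓘(𝕜, E) K) :
    mulInvariantVectorField v (1 : K) = v := by
  have h : (fun x : K => 1 * x) = id := by ext x; simp
  have h2 : mfderiv 𝓘(𝕜, E) 𝓘(𝕜, E) (fun x : K => 1 * x) 1 = ContinuousLinearMap.id 𝕜 E := by
    rw [h]; exact mfderiv_id
  rw [mulInvariantVectorField]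
  exact congrArg (fun L : E →L[𝕜] E => L v) h2

-- Differentiate `ρ (p * x) = ρ p * ρ x` in `x` at `1`. Values of derivatives are named by variables
-- in `A`, here and below, so that they can be multiplied there instead of lying in tangent spaces.
omit [CompleteSpace E] in
theorem mfderiv_algebraHom_mulInvariantVectorField {A : Type*} [NormedRing A] [NormedAlgebra 𝕜 A]
    (ρ : K →* A) (hρ : ContMDiff 𝓘(𝕜, E) 𝓘(𝕜, A) ω ρ) (v : GroupLieAlgebra 𝓘(𝕜, E) K) (p : K)
    {d : A} (hd : mfderiv 𝓘(𝕜, E) 𝓘(𝕜, A) ρ 1 v = d) :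
    mfderiv 𝓘(𝕜, E) 𝓘(𝕜, A) ρ p (mulInvariantVectorField v p) =
      ρ p * d := by
  subst hd
  have h1 : (ρ ∘ fun x => p * x) = (fun a : A => ρ p * a) ∘ ρ := by
    ext x; simp
  have hρ1 : ∀ x, MDifferentiableAt 𝓘(𝕜, E) 𝓘(𝕜, A) ρ x := fun x =>
    hρ.mdifferentiableAt (by simp)
  have hm : MDifferentiableAt 𝓘(𝕜, E) 𝓘(𝕜, E) (fun x : K => p * x) 1 :=
    (contMDiff_mul_left (I := 𝓘(𝕜, E)) (n := ω)).mdifferentiableAt (by simp)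
  have h2 := mfderiv_comp (I' := 𝓘(𝕜, E)) (1 : K) (hρ1 (p * 1)) hm
  have hl : HasFDerivAt (fun a : A => ρ p * a) (ContinuousLinearMap.mul 𝕜 A (ρ p)) (ρ 1) :=
    (ContinuousLinearMap.mul 𝕜 A (ρ p)).hasFDerivAt
  have h3 := mfderiv_comp (I' := 𝓘(𝕜, A)) (1 : K) hl.differentiableAt.mdifferentiableAt (hρ1 1)
  rw [h1, h3, mfderiv_eq_fderiv, hl.fderiv] at h2
  have h4 := congrArg (fun L : E →L[𝕜] A => L v) h2
  have h5 : ∀ q, q = p → ∀ w : E, (mfderiv 𝓘(𝕜, E) 𝓘(𝕜, A) ρ q w : A) =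
      mfderiv 𝓘(𝕜, E) 𝓘(𝕜, A) ρ p w := by
    rintro _ rfl w; rfl
  exact (h5 _ (mul_one p) _).symm.trans h4.symm

/-- The derivative of a representation of a Lie group is a representation of its Lie algebra. -/
theorem mfderiv_algebraHom_lie {A : Type*} [NormedRing A] [NormedAlgebra 𝕜 A]
    (ρ : K →* A) (hρ : ContMDiff 𝓘(𝕜, E) 𝓘(𝕜, A) ω ρ) (v w : GroupLieAlgebra 𝓘(𝕜, E) K)
    {d d' : A} (hd : mfderiv 𝓘(𝕜, E) 𝓘(𝕜, A) ρ 1 v = d)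
    (hd' : mfderiv 𝓘(𝕜, E) 𝓘(𝕜, A) ρ 1 w = d') :
    mfderiv 𝓘(𝕜, E) 𝓘(𝕜, A) ρ 1 ⁅v, w⁆ =
      d * d' - d' * d := by
  have key : ∀ (u' : GroupLieAlgebra 𝓘(𝕜, E) K) (e e' : A),
      mfderiv 𝓘(𝕜, E) 𝓘(𝕜, A) ρ 1 u' = e' →
      mfderiv 𝓘(𝕜, E) 𝓘(𝕜, A) (fun p => ρ p * e) 1
        (mulInvariantVectorField u' 1) =
      e' * e := by
    rintro u' e _ rfl
    rw [mulInvariantVectorField_one]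
    have hl : HasFDerivAt (fun a : A => a * e)
        ((ContinuousLinearMap.mul 𝕜 A).flip e) (ρ 1) :=
      ((ContinuousLinearMap.mul 𝕜 A).flip e).hasFDerivAt
    have h3 := mfderiv_comp (I' := 𝓘(𝕜, A)) (1 : K) hl.differentiableAt.mdifferentiableAt
      (hρ.mdifferentiableAt (x := 1) (by simp))
    rw [mfderiv_eq_fderiv, hl.fderiv] at h3
    exact congrArg (fun L : E →L[𝕜] A => L u') h3
  rw [GroupLieAlgebra.bracket_def]
  exact mfderiv_apply_mlieBracket (hρ.contMDiffAt.of_le le_top)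
    (mdifferentiableAt_mulInvariantVectorField v) (mdifferentiableAt_mulInvariantVectorField w)
    (Eventually.of_forall fun p => mfderiv_algebraHom_mulInvariantVectorField ρ hρ v p hd)
    (Eventually.of_forall fun p => mfderiv_algebraHom_mulInvariantVectorField ρ hρ w p hd')
    (key v d' d hd) (key w d d' hd')

-- Differentiating `φ (p * x) = φ p * φ x` at `x = 1` shows that corresponding left-invariant fields
-- are `φ`-related.
omit [CompleteSpace E] [CompleteSpace E'] in
theorem mfderiv_groupHom_mulInvariantVectorField (φ : K →* G)
    (hφ : ContMDiff 𝓘(𝕜, E) 𝓘(𝕜, E') ω φ) (v : GroupLieAlgebra 𝓘(𝕜, E) K) (p : K)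
    {v' : GroupLieAlgebra 𝓘(𝕜, E') G} (hv : v' = (mfderiv 𝓘(𝕜, E) 𝓘(𝕜, E') φ 1 v : E')) :
    mfderiv 𝓘(𝕜, E) 𝓘(𝕜, E') φ p (mulInvariantVectorField v p) =
      mulInvariantVectorField v' (φ p) := by
  have h1 : (φ ∘ fun x => p * x) = (fun a : G => φ p * a) ∘ φ := by
    ext x; simp
  have hφ1 : ∀ x, MDifferentiableAt 𝓘(𝕜, E) 𝓘(𝕜, E') φ x := fun x =>
    hφ.mdifferentiableAt (by simp)
  have hm : MDifferentiableAt 𝓘(𝕜, E) 𝓘(𝕜, E) (fun x : K => p * x) 1 :=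
    (contMDiff_mul_left (I := 𝓘(𝕜, E)) (n := ω)).mdifferentiableAt (by simp)
  have hm' : MDifferentiableAt 𝓘(𝕜, E') 𝓘(𝕜, E') (fun x : G => φ p * x) (φ 1) :=
    (contMDiff_mul_left (I := 𝓘(𝕜, E')) (n := ω)).mdifferentiableAt (by simp)
  have h2 := mfderiv_comp (I' := 𝓘(𝕜, E)) (1 : K) (hφ1 (p * 1)) hm
  have h3 := mfderiv_comp (I' := 𝓘(𝕜, E')) (1 : K) hm' (hφ1 1)
  rw [h1, h3] at h2
  have h4 := congrArg (fun L : E →L[𝕜] E' => L v) h2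
  have h5 : ∀ q, q = p → ∀ w : E, (mfderiv 𝓘(𝕜, E) 𝓘(𝕜, E') φ q w : E') =
      mfderiv 𝓘(𝕜, E) 𝓘(𝕜, E') φ p w := by
    rintro _ rfl w; rfl
  have h6 : ∀ q, q = 1 → ∀ w : E', (mfderiv 𝓘(𝕜, E') 𝓘(𝕜, E') (fun a : G => φ p * a) q w : E') =
      mfderiv 𝓘(𝕜, E') 𝓘(𝕜, E') (fun a : G => φ p * a) 1 w := by
    rintro _ rfl w; rfl
  subst hv
  exact ((h5 _ (mul_one p) _).symm.trans h4.symm).trans (h6 _ (map_one φ) _)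

/-- The derivative of a homomorphism of Lie groups is a homomorphism of Lie algebras. -/
theorem mfderiv_groupHom_lie (φ : K →* G)
    (hφ : ContMDiff 𝓘(𝕜, E) 𝓘(𝕜, E') ω φ) (v w : GroupLieAlgebra 𝓘(𝕜, E) K)
    {v' w' : GroupLieAlgebra 𝓘(𝕜, E') G} (hv : v' = (mfderiv 𝓘(𝕜, E) 𝓘(𝕜, E') φ 1 v : E'))
    (hw : w' = (mfderiv 𝓘(𝕜, E) 𝓘(𝕜, E') φ 1 w : E')) :
    (mfderiv 𝓘(𝕜, E) 𝓘(𝕜, E') φ 1 ⁅v, w⁆ : E') = ⁅v', w'⁆ := by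
  have : IsManifold 𝓘(𝕜, E') 1 G := IsManifold.of_le (n := ω) le_top
  -- The commutator formula needs a vector valued function. It is applied to a chart `χ` on `G` and
  -- to `χ ∘ φ` on `K`; since the fields are `φ`-related, both sides are the same commutator.
  set χ : G → E' := (extChartAt 𝓘(𝕜, E') (1 : G) : G → E') with hχ
  have hχ1 : ContMDiffAt 𝓘(𝕜, E') 𝓘(𝕜, E') 2 χ 1 := contMDiffAt_extChartAt.of_le le_top
  have hχ' : ∀ᶠ q in 𝓝 (1 : G), MDifferentiableAt 𝓘(𝕜, E') 𝓘(𝕜, E') χ q := by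
    filter_upwards [((contMDiffAt_iff_contMDiffAt_nhds (by simp)).mp hχ1)] with q hq
    exact hq.mdifferentiableAt (by simp)
  have hφ1 : ∀ x, MDifferentiableAt 𝓘(𝕜, E) 𝓘(𝕜, E') φ x := fun x =>
    hφ.mdifferentiableAt (by simp)
  let a : G → E' := fun q => mfderiv 𝓘(𝕜, E') 𝓘(𝕜, E') χ q (mulInvariantVectorField v' q)
  let b : G → E' := fun q => mfderiv 𝓘(𝕜, E') 𝓘(𝕜, E') χ q (mulInvariantVectorField w' q)
  have ha : MDifferentiableAt 𝓘(𝕜, E') 𝓘(𝕜, E') a 1 := mdifferentiableAt_mfderiv_apply hχ1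
    (mdifferentiableAt_mulInvariantVectorField v') (Eventually.of_forall fun _ => rfl)
  have hb : MDifferentiableAt 𝓘(𝕜, E') 𝓘(𝕜, E') b 1 := mdifferentiableAt_mfderiv_apply hχ1
    (mdifferentiableAt_mulInvariantVectorField w') (Eventually.of_forall fun _ => rfl)
  have hG := mfderiv_apply_mlieBracket hχ1
    (mdifferentiableAt_mulInvariantVectorField v') (mdifferentiableAt_mulInvariantVectorField w')
    (a := a) (b := b) (Eventually.of_forall fun _ => rfl) (Eventually.of_forall fun _ => rfl)
    rfl rfl
  have hc : Tendsto φ (𝓝 1) (𝓝 1) := by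
    have := hφ.continuous.tendsto 1
    rwa [map_one] at this
  have hat : ∀ {c : G → E'}, MDifferentiableAt 𝓘(𝕜, E') 𝓘(𝕜, E') c 1 → ∀ u : E,
      (mfderiv 𝓘(𝕜, E) 𝓘(𝕜, E') (c ∘ φ) 1 u : E') =
        mfderiv 𝓘(𝕜, E') 𝓘(𝕜, E') c 1 (mfderiv 𝓘(𝕜, E) 𝓘(𝕜, E') φ 1 u : E') := by
    intro c hc u
    have h6 : ∀ q, q = 1 → ∀ w : E', (mfderiv 𝓘(𝕜, E') 𝓘(𝕜, E') c q w : E') =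
        mfderiv 𝓘(𝕜, E') 𝓘(𝕜, E') c 1 w := by
      rintro _ rfl w; rfl
    have hc' : MDifferentiableAt 𝓘(𝕜, E') 𝓘(𝕜, E') c (φ 1) := by rwa [map_one]
    have h3 := mfderiv_comp (I' := 𝓘(𝕜, E')) (1 : K) hc' (hφ1 1)
    rw [h3]
    exact h6 _ (map_one φ) _
  have hder : ∀ (u : GroupLieAlgebra 𝓘(𝕜, E) K) (u' : GroupLieAlgebra 𝓘(𝕜, E') G),
      u' = (mfderiv 𝓘(𝕜, E) 𝓘(𝕜, E') φ 1 u : E') → ∀ᶠ p in 𝓝 (1 : K),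
      (mfderiv 𝓘(𝕜, E) 𝓘(𝕜, E') (χ ∘ φ) p (mulInvariantVectorField u p) : E') =
      mfderiv 𝓘(𝕜, E') 𝓘(𝕜, E') χ (φ p) (mulInvariantVectorField u' (φ p)) := by
    intro u u' hu
    filter_upwards [hc.eventually hχ'] with p hp
    rw [mfderiv_comp (I' := 𝓘(𝕜, E')) p hp (hφ1 p)]
    exact congrArg (fun z : E' => mfderiv 𝓘(𝕜, E') 𝓘(𝕜, E') χ (φ p) z)
      (mfderiv_groupHom_mulInvariantVectorField φ hφ u p hu)
  have hχφ : ContMDiffAt 𝓘(𝕜, E) 𝓘(𝕜, E') 2 (χ ∘ φ) 1 := by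
    refine ContMDiffAt.comp (1 : K) ?_ (hφ.contMDiffAt.of_le le_top)
    rwa [map_one]
  have hK := mfderiv_apply_mlieBracket hχφ
    (mdifferentiableAt_mulInvariantVectorField v) (mdifferentiableAt_mulInvariantVectorField w)
    (a := a ∘ φ) (b := b ∘ φ) (hder v v' hv) (hder w w' hw) rfl rfl
  rw [mulInvariantVectorField_one, mulInvariantVectorField_one] at hK hG
  have hb' : (mfderiv 𝓘(𝕜, E) 𝓘(𝕜, E') (b ∘ φ) 1 v : E') = mfderiv 𝓘(𝕜, E') 𝓘(𝕜, E') b 1 v' := by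
    rw [hv]
    exact hat hb v
  have ha' : (mfderiv 𝓘(𝕜, E) 𝓘(𝕜, E') (a ∘ φ) 1 w : E') = mfderiv 𝓘(𝕜, E') 𝓘(𝕜, E') a 1 w' := by
    rw [hw]
    exact hat ha w
  have hχφ' := (hat (hχ1.mdifferentiableAt (by simp))
    (⁅v, w⁆ : GroupLieAlgebra 𝓘(𝕜, E) K)).symm.trans
    (hK.trans (congrArg₂ (fun x y : E' => x - y) hb' ha'))
  -- The two brackets have the same image under the derivative of `χ` at `1`, which is invertible.
  have hinj := (isInvertible_mfderiv_extChartAt (I := 𝓘(𝕜, E'))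
      (mem_extChartAt_source (I := 𝓘(𝕜, E')) (1 : G))).injective
  exact hinj (hχφ'.trans hG.symm)

end LieGroupHom

end

/-! ### Passage between a connected Lie group and its Lie algebra. -/

section

open Filter Topology

section Connected

variable {𝕜 : Type*} [RCLike 𝕜] {E F : Type*} [NormedAddCommGroup E] [NormedSpace 𝕜 E]
  [NormedAddCommGroup F] [NormedSpace 𝕜 F]

theorem isLocallyConstant_of_mfderiv_eq_zero {M : Type*} [TopologicalSpace M] [ChartedSpace E M]
    [IsManifold 𝓘(𝕜, E) ω M] {f : M → F} (hf : MDifferentiable 𝓘(𝕜, E) 𝓘(𝕜, F) f)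
    (h0 : ∀ x, mfderiv 𝓘(𝕜, E) 𝓘(𝕜, F) f x = 0) : IsLocallyConstant f := by
  rw [IsLocallyConstant.iff_eventually_eq]
  intro x₀
  have : IsManifold 𝓘(𝕜, E) 1 M := IsManifold.of_le (n := ω) le_top
  -- Convexity of balls, used for their connectedness, refers to the underlying real structure.
  let : NormedSpace ℝ E := .restrictScalars ℝ 𝕜 E
  obtain ⟨ε, hε, hball⟩ := Metric.mem_nhds_iff.mp
    (extChartAt_target_mem_nhds (I := 𝓘(𝕜, E)) x₀)
  have hder : ∀ y ∈ Metric.ball (extChartAt 𝓘(𝕜, E) x₀ x₀) ε,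
      HasFDerivAt (f ∘ (extChartAt 𝓘(𝕜, E) x₀).symm) (0 : E →L[𝕜] F) y := by
    intro y hy
    have hinv := isInvertible_mfderivWithin_extChartAt_symm (I := 𝓘(𝕜, E)) (hball hy)
    simp only [modelWithCornersSelf_coe, Set.range_id, mfderivWithin_univ] at hinv
    have hs : MDifferentiableAt 𝓘(𝕜, E) 𝓘(𝕜, E) (extChartAt 𝓘(𝕜, E) x₀).symm y :=
      mdifferentiableAt_of_isInvertible_mfderiv hinv
    have h1 := (hf ((extChartAt 𝓘(𝕜, E) x₀).symm y)).hasMFDerivAt.comp y hs.hasMFDerivAt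
    rw [h0] at h1
    have h2 := h1.hasFDerivAt
    convert! h2 using 1
  have hconst : ∀ y ∈ Metric.ball (extChartAt 𝓘(𝕜, E) x₀ x₀) ε,
      (f ∘ (extChartAt 𝓘(𝕜, E) x₀).symm) y =
        (f ∘ (extChartAt 𝓘(𝕜, E) x₀).symm) (extChartAt 𝓘(𝕜, E) x₀ x₀) := fun y hy =>
    Metric.isOpen_ball.is_const_of_fderiv_eq_zero (𝕜 := 𝕜)
      (convex_ball _ _).isPreconnected
      (fun z hz => (hder z hz).differentiableAt.differentiableWithinAt)
      (fun z hz => (hder z hz).fderiv) hy (Metric.mem_ball_self hε)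
  filter_upwards [extChartAt_source_mem_nhds (I := 𝓘(𝕜, E)) x₀,
    (continuousAt_extChartAt (I := 𝓘(𝕜, E)) x₀).preimage_mem_nhds (Metric.ball_mem_nhds _ hε)]
    with x hx hxb
  have := hconst _ hxb
  simpa only [Function.comp_apply, (extChartAt 𝓘(𝕜, E) x₀).left_inv hx,
    (extChartAt 𝓘(𝕜, E) x₀).left_inv (mem_extChartAt_source (I := 𝓘(𝕜, E)) x₀)] using this

variable {K : Type*} [TopologicalSpace K] [ChartedSpace E K] [Group K] [LieGroup 𝓘(𝕜, E) ω K]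
  {A : Type*} [NormedRing A] [NormedAlgebra 𝕜 A]

omit [Group K] [LieGroup 𝓘(𝕜, E) ω K] in
theorem mfderiv_mul_apply {f g h : K → A} {x : K} (hfg : ∀ q, h q = f q * g q)
    (hf : MDifferentiableAt 𝓘(𝕜, E) 𝓘(𝕜, A) f x)
    (hg : MDifferentiableAt 𝓘(𝕜, E) 𝓘(𝕜, A) g x) {v : TangentSpace 𝓘(𝕜, E) x} {a b : A}
    (ha : mfderiv 𝓘(𝕜, E) 𝓘(𝕜, A) f x v = a) (hb : mfderiv 𝓘(𝕜, E) 𝓘(𝕜, A) g x v = b) :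
    mfderiv 𝓘(𝕜, E) 𝓘(𝕜, A) h x v = f x * b + a * g x := by
  subst ha hb
  obtain rfl : h = f * g := funext hfg
  have h := (hf.hasMFDerivAt.mul' hg.hasMFDerivAt).mfderiv
  exact congrArg (fun L : E →L[𝕜] A => L v) h

/-- An element that commutes with the derivative of a representation of a connected Lie group
commutes with the representation. -/
theorem commute_of_forall_commute_mfderiv [ConnectedSpace K] (ρ : K →* A)
    (hρ : ContMDiff 𝓘(𝕜, E) 𝓘(𝕜, A) ω ρ) (c : A)
    (hc : ∀ (v : E) (d : A), mfderiv 𝓘(𝕜, E) 𝓘(𝕜, A) ρ 1 v = d → Commute c d) (p : K) :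
    Commute c (ρ p) := by
  have hinv : ∀ q : K, ρ q⁻¹ * ρ q = 1 := fun q => by rw [← map_mul]; simp
  have hinv' : ∀ q : K, ρ q * ρ q⁻¹ = 1 := fun q => by rw [← map_mul]; simp
  have hρ1 : ∀ x, MDifferentiableAt 𝓘(𝕜, E) 𝓘(𝕜, A) ρ x := fun x =>
    hρ.mdifferentiableAt (by simp)
  -- The conjugate of `c` by `ρ q` has zero derivative everywhere, so it keeps its value `c` at `q =
  -- 1`.
  let f : K → A := fun q => ρ q * c * ρ q⁻¹
  have hf : ContMDiff 𝓘(𝕜, E) 𝓘(𝕜, A) ω f := by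
    have hi : ContMDiff 𝓘(𝕜, E) 𝓘(𝕜, A) ω (fun q : K => ρ q⁻¹) :=
      hρ.comp (contMDiff_inv 𝓘(𝕜, E) ω)
    have hm : ContDiff 𝕜 ω (fun x : A × A => x.1 * c * x.2) := by fun_prop
    exact hm.contMDiff.comp (hρ.prodMk_space hi)
  have hf1 : ∀ x, MDifferentiableAt 𝓘(𝕜, E) 𝓘(𝕜, A) f x := fun x =>
    hf.mdifferentiableAt (by simp)
  have hfρ : (fun q => f q * ρ q) = fun q => ρ q * c := by
    funext q; simp only [f, mul_assoc, hinv, mul_one]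
  -- Differentiating `f q * ρ q = ρ q * c` avoids the derivative of the inverse: it gives `d * c = c
  -- * d + y`, where `y` is the derivative of `f`.
  have hd1 : mfderiv 𝓘(𝕜, E) 𝓘(𝕜, A) f 1 = 0 := by
    ext v
    obtain ⟨d, hd⟩ : ∃ d : A, mfderiv 𝓘(𝕜, E) 𝓘(𝕜, A) ρ 1 v = d := ⟨_, rfl⟩
    obtain ⟨y, hy⟩ : ∃ y : A, mfderiv 𝓘(𝕜, E) 𝓘(𝕜, A) f 1 v = y := ⟨_, rfl⟩
    have h1 := mfderiv_mul_apply (h := fun q => ρ q * c) (fun q => (congrFun hfρ q).symm)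
      (hf1 1) (hρ1 1) hy hd
    have h2 := mfderiv_mul_apply (h := fun q => ρ q * c) (fun _ => rfl) (hρ1 1)
      (mdifferentiableAt_const (c := c)) hd (b := 0) (by rw [mfderiv_const]; rfl)
    have h3 : f 1 = c := by simp [f]
    have h4 : c * d = d * c := hc v d hd
    have h5 : ρ 1 * 0 + d * c = f 1 * d + y * ρ 1 := h2.symm.trans h1
    rw [h3, h4, mul_zero, zero_add, map_one, mul_one] at h5
    exact hy.trans (left_eq_add.mp h5)
  have hd : ∀ q, mfderiv 𝓘(𝕜, E) 𝓘(𝕜, A) f q = 0 := by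
    intro q
    -- Equivariance of `f` under left translation carries the vanishing of the derivative from `1`
    -- to `q`.
    have hfq : f = (fun a => ρ q * a * ρ q⁻¹) ∘ f ∘ (fun x => q⁻¹ * x) := by
      funext x
      simp only [f, Function.comp_apply, map_mul, mul_inv_rev, inv_inv]
      have : ρ q * (ρ q⁻¹ * ρ x * c * (ρ x⁻¹ * ρ q)) * ρ q⁻¹ =
        (ρ q * ρ q⁻¹) * (ρ x * c * ρ x⁻¹) * (ρ q * ρ q⁻¹) := by noncomm_ring
      rw [this, hinv', one_mul, mul_one]
    have hm : MDifferentiableAt 𝓘(𝕜, E) 𝓘(𝕜, E) (fun x : K => q⁻¹ * x) q :=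
      (contMDiff_mul_left (I := 𝓘(𝕜, E)) (n := ω)).mdifferentiableAt (by simp)
    have hl : MDifferentiable 𝓘(𝕜, A) 𝓘(𝕜, A) (fun a : A => ρ q * a * ρ q⁻¹) := by
      have : Differentiable 𝕜 (fun a : A => ρ q * a * ρ q⁻¹) := by fun_prop
      exact this.mdifferentiable
    have h0 : mfderiv 𝓘(𝕜, E) 𝓘(𝕜, A) f (q⁻¹ * q) = 0 := by rw [inv_mul_cancel]; exact hd1
    have h1 := mfderiv_comp (I' := 𝓘(𝕜, E)) q (hf1 (q⁻¹ * q)) hm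
    rw [h0] at h1
    have h2 := mfderiv_comp (I' := 𝓘(𝕜, A)) q (hl _) ((hf1 (q⁻¹ * q)).comp q hm)
    rw [← hfq, h1] at h2
    rw [h2]
    exact ContinuousLinearMap.ext fun v =>
      (mfderiv 𝓘(𝕜, A) 𝓘(𝕜, A) (fun a : A => ρ q * a * ρ q⁻¹) _ : A →L[𝕜] A).map_zero
  have hconst :=
    (isLocallyConstant_of_mfderiv_eq_zero (fun x => hf1 x) hd).apply_eq_of_preconnectedSpace p 1
  have h1 : f 1 = c := by simp [f]
  rw [h1] at hconst
  have := congrFun hfρ p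
  simp only [hconst] at this
  exact this

omit [LieGroup 𝓘(𝕜, E) ω K] in
theorem commute_mfderiv_of_forall_commute (ρ : K →* A)
    (hρ : ContMDiff 𝓘(𝕜, E) 𝓘(𝕜, A) ω ρ) (c : A) (hc : ∀ p, Commute c (ρ p)) (v : E)
    {d : A} (hd : mfderiv 𝓘(𝕜, E) 𝓘(𝕜, A) ρ 1 v = d) : Commute c d := by
  have hρ1 : MDifferentiableAt 𝓘(𝕜, E) 𝓘(𝕜, A) ρ 1 := hρ.mdifferentiableAt (by simp)
  have h1 := mfderiv_mul_apply (h := fun q => ρ q * c) (fun _ => rfl) hρ1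
    (mdifferentiableAt_const (c := c)) hd (b := 0) (by rw [mfderiv_const]; rfl)
  have h2 := mfderiv_mul_apply (h := fun q => ρ q * c) (fun q => (hc q).symm.eq)
    (mdifferentiableAt_const (c := c)) hρ1 (a := 0) (by rw [mfderiv_const]; rfl) hd
  have h3 : ρ 1 * 0 + d * c = c * d + 0 * ρ 1 := h1.symm.trans h2
  rw [mul_zero, zero_mul, zero_add, add_zero] at h3
  exact h3.symm

end Connected

end

/-! ### Local sections of submersions, and smoothness of operator valued maps. -/

section

open Filter Topology

section LocalSection

variable {𝕜 : Type*} [NontriviallyNormedField 𝕜] {E F : Type*} [NormedAddCommGroup E]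
  [NormedSpace 𝕜 E] [NormedAddCommGroup F] [NormedSpace 𝕜 F]
  {M N : Type*} [TopologicalSpace M] [ChartedSpace E M]
  [TopologicalSpace N] [ChartedSpace F N]

/-- A submersion has local sections. -/
theorem exists_localSection {f : M → N} {x : M}
    (hf : Manifold.IsSubmersionAt 𝓘(𝕜, E) 𝓘(𝕜, F) ω f x) :
    ∃ σ : N → M, ContMDiffAt 𝓘(𝕜, F) 𝓘(𝕜, E) ω σ (f x) ∧ ∀ᶠ y in 𝓝 (f x), f (σ y) = y := by
  obtain ⟨C, _, _, h⟩ := hf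
  set φ := h.domChart
  set ψ := h.codChart
  have hxφ : x ∈ φ.source := h.mem_domChart_source
  have hxψ : f x ∈ ψ.source := h.mem_codChart_source
  have hloc : ∀ z ∈ φ.target, ψ (f (φ.symm z)) = (h.equiv z).1 := by
    intro z hz
    have hz' : z ∈ (φ.extend 𝓘(𝕜, E)).target := by simpa using hz
    have := h.writtenInCharts hz'
    simpa using this
  -- In adapted charts `f` is a projection to the first factor. The section keeps the second
  -- coordinate equal to that of `x`, so that it passes through `x`.
  let τ : N → E := fun y => h.equiv.symm (ψ y, (h.equiv (φ x)).2)
  have hτx : τ (f x) = φ x := by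
    have h1 := hloc (φ x) (φ.map_source hxφ)
    rw [φ.left_inv hxφ] at h1
    simp only [τ, h1]
    exact h.equiv.symm_apply_apply _
  have hψ : ContMDiffAt 𝓘(𝕜, F) 𝓘(𝕜, F) ω ψ (f x) :=
    (contMDiffOn_of_mem_maximalAtlas h.codChart_mem_maximalAtlas).contMDiffAt
      (ψ.open_source.mem_nhds hxψ)
  have hτ : ContMDiffAt 𝓘(𝕜, F) 𝓘(𝕜, E) ω τ (f x) := by
    have h2 : ContDiff 𝕜 ω (fun u : F => h.equiv.symm (u, (h.equiv (φ x)).2)) := by fun_prop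
    exact h2.contMDiff.contMDiffAt.comp (f x) hψ
  refine ⟨fun y => φ.symm (τ y), ?_, ?_⟩
  · refine ContMDiffAt.comp (f x) ?_ hτ
    rw [hτx]
    exact (contMDiffOn_symm_of_mem_maximalAtlas h.domChart_mem_maximalAtlas).contMDiffAt
      (φ.open_target.mem_nhds (φ.map_source hxφ))
  · have h3 : ∀ᶠ y in 𝓝 (f x), τ y ∈ φ.target :=
      hτ.continuousAt.preimage_mem_nhds
        (φ.open_target.mem_nhds (hτx ▸ φ.map_source hxφ))
    filter_upwards [h3, ψ.open_source.mem_nhds hxψ] with y hy hyψ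
    have h4 := hloc _ hy
    simp only [τ, ContinuousLinearEquiv.apply_symm_apply] at h4
    exact ψ.injOn (h.mapsto_domChart_source_codChart_source (φ.map_target hy)) hyψ h4

end LocalSection

section Clm

variable {E M : Type*} [NormedAddCommGroup E] [NormedSpace ℂ E] [TopologicalSpace M]
  [ChartedSpace E M]

/-- A map to a space of endomorphisms is smooth if its values at all vectors are. -/
theorem contMDiffAt_clm_of_forall_apply {r : ℕ} {n : ℕ∞ω} {f : M → (Cn r →L[ℂ] Cn r)} {x : M}
    (h : ∀ v, ContMDiffAt 𝓘(ℂ, E) 𝓘(ℂ, Cn r) n (fun y => f y v) x) :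
    ContMDiffAt 𝓘(ℂ, E) 𝓘(ℂ, Cn r →L[ℂ] Cn r) n f x := by
  let B := (EuclideanSpace.basisFun (Fin r) ℂ).toBasis
  let Φ : (Fin r → Cn r) →L[ℂ] (Cn r →L[ℂ] Cn r) :=
    LinearMap.toContinuousLinearMap
      (LinearMap.toContinuousLinearMap.toLinearMap ∘ₗ (B.constr ℂ).toLinearMap)
  have h1 : f = Φ ∘ fun y i => f y (B i) := by
    funext y
    refine ContinuousLinearMap.coe_injective (B.ext fun i => ?_)
    simp [Φ]
  rw [h1]
  refine Φ.contDiff.contMDiff.contMDiffAt.comp x ?_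
  exact contMDiffAt_pi_space.mpr fun i => h (B i)

end Clm

end

/-! ### Invariant families of endomorphisms and the fibre at the base point. -/

section

open Filter Topology

/-- Identities in a fibre are checked in the total space, where `fibreCast` disappears and the group
law holds without transports. -/
theorem eq_of_totalSpace_mk_eq {B F : Type*} {E : B → Type*} {x : B} {v w : E x}
    (h : (⟨x, v⟩ : Bundle.TotalSpace F E) = ⟨x, w⟩) : v = w :=
  (Bundle.TotalSpace.mk_inj (F := F)).mp h

namespace HomogeneousStructure

section

variable {d m r : ℕ} {G : Type*} [TopologicalSpace G] [ChartedSpace (Cn d) G] [Group G]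
  {P : Subgroup G} [ChartedSpace (Cn m) (G ⧸ P)]
  {E : G ⧸ P → Type*} [TopologicalSpace (Bundle.TotalSpace (Cn r) E)]
  [∀ x, AddCommGroup (E x)] [∀ x, Module ℂ (E x)] [∀ x, TopologicalSpace (E x)]
  [FiberBundle (Cn r) E] [VectorBundle ℂ (Cn r) E] (A : HomogeneousStructure d m r E)

/-- The action of `G` on the total space. -/
def totalAct (g : G) (z : Bundle.TotalSpace (Cn r) E) : Bundle.TotalSpace (Cn r) E :=
  ⟨g • z.1, A.act g z.1 z.2⟩

theorem totalAct_one (z : Bundle.TotalSpace (Cn r) E) : A.totalAct 1 z = z :=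
  A.one_act z.1 z.2

theorem totalAct_mul (g h : G) (z : Bundle.TotalSpace (Cn r) E) :
    A.totalAct (g * h) z = A.totalAct g (A.totalAct h z) :=
  A.mul_act g h z.1 z.2

/-- The map from the fibre at the base point to the fibre at `g • o`. -/
def fibreMap (g : G) : E ((1 : G) : G ⧸ P) →ₗ[ℂ] E (g : G ⧸ P) :=
  fibreCast (show g • ((1 : G) : G ⧸ P) = (g : G ⧸ P) by
    rw [MulAction.Quotient.smul_coe, smul_eq_mul, mul_one]) ∘ₗ A.act g _

theorem mk_fibreMap (g : G) (v : E ((1 : G) : G ⧸ P)) :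
    (⟨(g : G ⧸ P), A.fibreMap g v⟩ : Bundle.TotalSpace (Cn r) E) =
      A.totalAct g ⟨((1 : G) : G ⧸ P), v⟩ :=
  mk_fibreCast _ _

/-- The map from the fibre at `g • o` to the fibre at the base point. -/
def fibreMapInv (g : G) : E (g : G ⧸ P) →ₗ[ℂ] E ((1 : G) : G ⧸ P) :=
  fibreCast (show g⁻¹ • (g : G ⧸ P) = ((1 : G) : G ⧸ P) by
    rw [MulAction.Quotient.smul_coe, smul_eq_mul, inv_mul_cancel]) ∘ₗ A.act g⁻¹ _

theorem mk_fibreMapInv (g : G) (v : E (g : G ⧸ P)) :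
    (⟨((1 : G) : G ⧸ P), A.fibreMapInv g v⟩ : Bundle.TotalSpace (Cn r) E) =
      A.totalAct g⁻¹ ⟨(g : G ⧸ P), v⟩ :=
  mk_fibreCast _ _

theorem fibreMap_fibreMapInv (g : G) (v : E (g : G ⧸ P)) :
    A.fibreMap g (A.fibreMapInv g v) = v := by
  refine eq_of_totalSpace_mk_eq (F := Cn r) ?_
  rw [mk_fibreMap, mk_fibreMapInv, ← totalAct_mul, mul_inv_cancel, totalAct_one]

theorem fibreMapInv_fibreMap (g : G) (v : E ((1 : G) : G ⧸ P)) :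
    A.fibreMapInv g (A.fibreMap g v) = v := by
  refine eq_of_totalSpace_mk_eq (F := Cn r) ?_
  rw [mk_fibreMapInv, mk_fibreMap, ← totalAct_mul, inv_mul_cancel, totalAct_one]

theorem act_fibreMap (g h : G) (v : E ((1 : G) : G ⧸ P)) :
    A.act g (h : G ⧸ P) (A.fibreMap h v) = A.fibreMap (g * h) v := by
  refine eq_of_totalSpace_mk_eq (F := Cn r) ?_
  have h1 := A.mk_fibreMap (g * h) v
  rw [totalAct_mul, ← mk_fibreMap] at h1
  exact h1.symm

/-- A family of endomorphisms of the fibres that is invariant under `G` is determined by its value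
at the base point. -/
theorem apply_fibreMap {s : ∀ x : G ⧸ P, E x → E x}
    (hs : ∀ (g : G) (x : G ⧸ P) (v : E x), s (g • x) (A.act g x v) = A.act g x (s x v))
    (g : G) (v : E ((1 : G) : G ⧸ P)) :
    s (g : G ⧸ P) (A.fibreMap g v) = A.fibreMap g (s _ v) := by
  -- With the endpoint generalised to a variable, the equality of points can be substituted and the
  -- transport becomes the identity.
  have key : ∀ (x : G ⧸ P) (hx : g • ((1 : G) : G ⧸ P) = x),
      s x (fibreCast hx (A.act g _ v)) = fibreCast hx (A.act g _ (s _ v)) := by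
    rintro _ rfl
    exact hs g _ v
  exact key _ _

theorem apply_isotropyMap {s : ∀ x : G ⧸ P, E x → E x}
    (hs : ∀ (g : G) (x : G ⧸ P) (v : E x), s (g • x) (A.act g x v) = A.act g x (s x v))
    (p : P) (v : E ((1 : G) : G ⧸ P)) :
    s _ (A.isotropyMap p v) = A.isotropyMap p (s _ v) := by
  have key : ∀ (x : G ⧸ P) (hx : (p : G) • ((1 : G) : G ⧸ P) = x),
      s x (fibreCast hx (A.act p _ v)) = fibreCast hx (A.act p _ (s _ v)) := by
    rintro _ rfl
    exact hs p _ v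
  exact key _ _

theorem fibreMap_mul_isotropyMap (g : G) (p : P) (v : E ((1 : G) : G ⧸ P)) :
    (⟨((g * p : G) : G ⧸ P), A.fibreMap (g * p) v⟩ : Bundle.TotalSpace (Cn r) E) =
      ⟨(g : G ⧸ P), A.fibreMap g (A.isotropyMap p v)⟩ := by
  rw [mk_fibreMap, mk_fibreMap, totalAct_mul, mk_isotropyMap]
  rfl

/-- The family of endomorphisms of the fibres attached to an endomorphism of the fibre at the base
point. -/
def spread (φ : Module.End ℂ (E ((1 : G) : G ⧸ P))) (x : G ⧸ P) : Module.End ℂ (E x) :=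
  fibreCast (Quotient.out_eq' x) ∘ₗ A.fibreMap x.out ∘ₗ φ ∘ₗ A.fibreMapInv x.out ∘ₗ
    fibreCast (Quotient.out_eq' x).symm

/-- Two representatives of a coset differ by an element of `P`, which can be moved across `φ`. Thus
the representative chosen in `spread` does not matter. -/
theorem spread_fibreMap {φ : Module.End ℂ (E ((1 : G) : G ⧸ P))}
    (hφ : ∀ (p : P) v, φ (A.isotropyMap p v) = A.isotropyMap p (φ v)) (g : G)
    (v : E ((1 : G) : G ⧸ P)) :
    A.spread φ (g : G ⧸ P) (A.fibreMap g v) = A.fibreMap g (φ v) := by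
  have key : ∀ (x : G ⧸ P) (h : G) (hx : (h : G ⧸ P) = x) (hg : (g : G ⧸ P) = x),
      fibreCast hx (A.fibreMap h (φ (A.fibreMapInv h (fibreCast hx.symm
        (fibreCast hg (A.fibreMap g v)))))) = fibreCast hg (A.fibreMap g (φ v)) := by
    intro x h hx hg
    obtain ⟨p, rfl⟩ : ∃ p : P, g = h * p :=
      ⟨⟨h⁻¹ * g, QuotientGroup.eq.mp (hx.trans hg.symm)⟩, by simp⟩
    have h1 : fibreCast hx.symm (fibreCast hg (A.fibreMap (h * p) v)) =
        A.fibreMap h (A.isotropyMap p v) := by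
      refine eq_of_totalSpace_mk_eq (F := Cn r) ?_
      rw [mk_fibreCast, mk_fibreCast, fibreMap_mul_isotropyMap]
    rw [h1, fibreMapInv_fibreMap, hφ]
    refine eq_of_totalSpace_mk_eq (F := Cn r) ?_
    rw [mk_fibreCast, mk_fibreCast, fibreMap_mul_isotropyMap]
  exact key _ _ (Quotient.out_eq' _) rfl

theorem spread_act {φ : Module.End ℂ (E ((1 : G) : G ⧸ P))}
    (hφ : ∀ (p : P) v, φ (A.isotropyMap p v) = A.isotropyMap p (φ v)) (g : G) (x : G ⧸ P)
    (v : E x) : A.spread φ (g • x) (A.act g x v) = A.act g x (A.spread φ x v) := by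
  obtain ⟨h, rfl⟩ := QuotientGroup.mk_surjective x
  obtain ⟨u, rfl⟩ : ∃ u, A.fibreMap h u = v := ⟨_, A.fibreMap_fibreMapInv h v⟩
  rw [spread_fibreMap A hφ, act_fibreMap, act_fibreMap]
  exact spread_fibreMap A hφ (g * h) u

theorem spread_one {φ : Module.End ℂ (E ((1 : G) : G ⧸ P))}
    (hφ : ∀ (p : P) v, φ (A.isotropyMap p v) = A.isotropyMap p (φ v)) :
    A.spread φ ((1 : G) : G ⧸ P) = φ := by
  ext v
  have h1 := spread_fibreMap A hφ 1 v
  have h2 : ∀ u, A.fibreMap 1 u = u := by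
    intro u
    refine eq_of_totalSpace_mk_eq (F := Cn r) ?_
    rw [mk_fibreMap, totalAct_one]
  rwa [h2, h2] at h1

/-- The representatives given by `Quotient.out` have no regularity in `x`. This form allows any
representative, in particular the value of a holomorphic local section. -/
theorem mk_spread {φ : Module.End ℂ (E ((1 : G) : G ⧸ P))}
    (hφ : ∀ (p : P) v, φ (A.isotropyMap p v) = A.isotropyMap p (φ v)) {g : G} {x : G ⧸ P}
    (hg : (g : G ⧸ P) = x) (v : E x) (u : E ((1 : G) : G ⧸ P))
    (hu : (⟨_, u⟩ : Bundle.TotalSpace (Cn r) E) = A.totalAct g⁻¹ ⟨x, v⟩) :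
    (⟨x, A.spread φ x v⟩ : Bundle.TotalSpace (Cn r) E) = A.totalAct g ⟨_, φ u⟩ := by
  subst hg
  rw [← mk_fibreMapInv] at hu
  obtain rfl := eq_of_totalSpace_mk_eq hu
  rw [← mk_fibreMap, ← spread_fibreMap A hφ, fibreMap_fibreMapInv]

/-- Linear maps between fibres are continuous. -/
theorem continuous_fibre_end (r : ℕ) {E : G ⧸ P → Type*}
    [TopologicalSpace (Bundle.TotalSpace (Cn r) E)]
    [∀ x, AddCommGroup (E x)] [∀ x, Module ℂ (E x)] [∀ x, TopologicalSpace (E x)]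
    [FiberBundle (Cn r) E] [VectorBundle ℂ (Cn r) E] {x : G ⧸ P} (f : Module.End ℂ (E x)) :
    Continuous f := by
  let e := (trivializationAt (Cn r) E x).continuousLinearEquivAt ℂ x
    (FiberBundle.mem_baseSet_trivializationAt' x)
  have h1 : (f : E x → E x) =
      e.symm ∘ (e.toLinearEquiv.conj f : Module.End ℂ (Cn r)) ∘ e := by
    funext v
    simp only [LinearEquiv.conj_apply, Function.comp_apply, LinearMap.comp_apply]
    exact (e.symm_apply_apply (f v)).symm.trans
      (by simp [-Bundle.Trivialization.continuousLinearEquivAt_apply])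
  rw [h1]
  exact e.symm.continuous.comp ((LinearMap.continuous_of_finiteDimensional _).comp e.continuous)

end

end HomogeneousStructure

end

/-! ### Holomorphy, and the equivalence with the commutant of `P`. -/

section

open Filter Topology

namespace HomogeneousStructure

section

variable {d m r : ℕ} {G : Type*} [TopologicalSpace G] [ChartedSpace (Cn d) G] [Group G]
  {P : Subgroup G} [ChartedSpace (Cn m) (G ⧸ P)]
  {E : G ⧸ P → Type*} [TopologicalSpace (Bundle.TotalSpace (Cn r) E)]
  [∀ x, AddCommGroup (E x)] [∀ x, Module ℂ (E x)] [∀ x, TopologicalSpace (E x)]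
  [FiberBundle (Cn r) E] [VectorBundle ℂ (Cn r) E] (A : HomogeneousStructure d m r E)
  {F M : Type*} [NormedAddCommGroup F] [NormedSpace ℂ F] [TopologicalSpace M] [ChartedSpace F M]

theorem contMDiffAt_fibreEquiv {f : M → E ((1 : G) : G ⧸ P)} {x : M}
    (hf : ContMDiffAt 𝓘(ℂ, F) (𝓘(ℂ, Cn m).prod 𝓘(ℂ, Cn r)) ω
      (fun y => (⟨_, f y⟩ : Bundle.TotalSpace (Cn r) E)) x) :
    ContMDiffAt 𝓘(ℂ, F) 𝓘(ℂ, Cn r) ω (fun y => fibreEquiv (r := r) E (f y)) x :=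
  (Bundle.contMDiffAt_totalSpace.mp hf).2

theorem contMDiffAt_mk_fibreEquiv_symm {f : M → Cn r} {x : M}
    (hf : ContMDiffAt 𝓘(ℂ, F) 𝓘(ℂ, Cn r) ω f x) :
    ContMDiffAt 𝓘(ℂ, F) (𝓘(ℂ, Cn m).prod 𝓘(ℂ, Cn r)) ω
      (fun y => (⟨_, (fibreEquiv E).symm (f y)⟩ : Bundle.TotalSpace (Cn r) E)) x := by
  refine Bundle.contMDiffAt_totalSpace.mpr ⟨contMDiffAt_const, ?_⟩
  refine hf.congr_of_eventuallyEq (Eventually.of_forall fun y => ?_)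
  exact (fibreEquiv E).apply_symm_apply (f y)

theorem contMDiffAt_totalAct {f : M → G} {z : M → Bundle.TotalSpace (Cn r) E} {x : M}
    (hf : ContMDiffAt 𝓘(ℂ, F) 𝓘(ℂ, Cn d) ω f x)
    (hz : ContMDiffAt 𝓘(ℂ, F) (𝓘(ℂ, Cn m).prod 𝓘(ℂ, Cn r)) ω z x) :
    ContMDiffAt 𝓘(ℂ, F) (𝓘(ℂ, Cn m).prod 𝓘(ℂ, Cn r)) ω (fun y => A.totalAct (f y) (z y)) x :=
  ContMDiffAt.comp x (A.holomorphic (f x, z x)) (hf.prodMk hz)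

theorem contMDiff_rep {e : ℕ} [ChartedSpace (Cn e) P]
    (hP : ContMDiff 𝓘(ℂ, Cn e) 𝓘(ℂ, Cn d) ω (P.subtype : P → G)) :
    ContMDiff 𝓘(ℂ, Cn e) 𝓘(ℂ, Cn r →L[ℂ] Cn r) ω A.rep := by
  intro p
  refine contMDiffAt_clm_of_forall_apply fun v => ?_
  have h1 : ContMDiffAt 𝓘(ℂ, Cn e) (𝓘(ℂ, Cn m).prod 𝓘(ℂ, Cn r)) ω
      (fun q : P => (⟨_, A.isotropyMap q ((fibreEquiv E).symm v)⟩ :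
        Bundle.TotalSpace (Cn r) E)) p := by
    refine (A.contMDiffAt_totalAct (hP p)
      (contMDiffAt_const (c := (⟨_, (fibreEquiv E).symm v⟩ :
        Bundle.TotalSpace (Cn r) E)))).congr_of_eventuallyEq
      (Eventually.of_forall fun q => A.mk_isotropyMap q _)
  exact contMDiffAt_fibreEquiv h1

variable [∀ x, IsTopologicalAddGroup (E x)] [∀ x, ContinuousSMul ℂ (E x)]

/-- An endomorphism of the fibre at the base point that commutes with `P` extends to a
holomorphic family of endomorphisms of the fibres. -/
theorem contMDiff_spread [LieGroup 𝓘(ℂ, Cn d) ω G] [IsManifold 𝓘(ℂ, Cn m) ω (G ⧸ P)]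
    [ContMDiffVectorBundle ω (Cn r) E 𝓘(ℂ, Cn m)]
    (hX : Manifold.IsSubmersion 𝓘(ℂ, Cn d) 𝓘(ℂ, Cn m) ω (fun g : G => (g : G ⧸ P)))
    {φ : Module.End ℂ (E ((1 : G) : G ⧸ P))}
    (hφ : ∀ (p : P) v, φ (A.isotropyMap p v) = A.isotropyMap p (φ v)) :
    ContMDiff 𝓘(ℂ, Cn m) (𝓘(ℂ, Cn m).prod 𝓘(ℂ, Cn r →L[ℂ] Cn r)) ω
      (fun x => Bundle.TotalSpace.mk' (Cn r →L[ℂ] Cn r) (E := fun x => E x →L[ℂ] E x) x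
        ⟨A.spread φ x, continuous_fibre_end r (A.spread φ x)⟩) := by
  intro x₀
  rw [contMDiffAt_hom_bundle]
  refine ⟨contMDiffAt_id, ?_⟩
  refine contMDiffAt_clm_of_forall_apply fun u => ?_
  obtain ⟨g₀, rfl⟩ := QuotientGroup.mk_surjective x₀
  -- Near the given point, the spread endomorphism is: move to the base point by `(σ x)⁻¹`, apply
  -- `φ`, move back by `σ x`. Each of these depends holomorphically on `x`.
  obtain ⟨σ, hσ, hσ'⟩ := exists_localSection (hX.isSubmersionAt g₀)
  set e := trivializationAt (Cn r) E (g₀ : G ⧸ P) with he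
  have hbase : (g₀ : G ⧸ P) ∈ e.baseSet := FiberBundle.mem_baseSet_trivializationAt' _
  have hw : ContMDiffAt 𝓘(ℂ, Cn m) (𝓘(ℂ, Cn m).prod 𝓘(ℂ, Cn r)) ω
      (fun x => (⟨x, e.symm x u⟩ : Bundle.TotalSpace (Cn r) E)) (g₀ : G ⧸ P) := by
    refine (e.contMDiffAt_section_iff hbase).mpr ?_
    refine (contMDiffAt_const (c := u)).congr_of_eventuallyEq ?_
    filter_upwards [e.open_baseSet.mem_nhds hbase] with x hx
    rw [e.apply_mk_symm hx]
  have hσi : ContMDiffAt 𝓘(ℂ, Cn m) 𝓘(ℂ, Cn d) ω (fun x => (σ x)⁻¹) (g₀ : G ⧸ P) := hσ.inv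
  -- the vector `e.symm x u`, moved to the base point
  let a : G ⧸ P → E ((1 : G) : G ⧸ P) := fun x =>
    A.fibreMapInv (σ x) (e.symm (σ x : G ⧸ P) u)
  -- The coset of `σ x` is `x` only near the given point, so `a` is defined over that coset and
  -- compared with `x` eventually.
  have ha' : ∀ᶠ x in 𝓝 (g₀ : G ⧸ P), (⟨_, a x⟩ : Bundle.TotalSpace (Cn r) E) =
      A.totalAct (σ x)⁻¹ ⟨x, e.symm x u⟩ := by
    filter_upwards [hσ'] with x hx
    rw [A.mk_fibreMapInv, hx]
  have ha := contMDiffAt_fibreEquiv ((A.contMDiffAt_totalAct hσi hw).congr_of_eventuallyEq ha')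
  let ψ : Cn r →L[ℂ] Cn r := LinearMap.toContinuousLinearMap ((fibreEquiv E).conj φ)
  have hb := A.contMDiffAt_totalAct hσ (contMDiffAt_mk_fibreEquiv_symm
    (ψ.contDiff.contMDiff.contMDiffAt.comp _ ha))
  have hs : ContMDiffAt 𝓘(ℂ, Cn m) (𝓘(ℂ, Cn m).prod 𝓘(ℂ, Cn r)) ω
      (fun x => (⟨x, A.spread φ x (e.symm x u)⟩ : Bundle.TotalSpace (Cn r) E))
      (g₀ : G ⧸ P) := by
    refine hb.congr_of_eventuallyEq ?_
    filter_upwards [ha', hσ'] with x hx hx'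
    rw [A.mk_spread hφ hx' _ _ hx]
    simp [ψ, LinearEquiv.conj_apply]
  refine ((e.contMDiffAt_section_iff hbase).mp hs).congr_of_eventuallyEq ?_
  filter_upwards [e.open_baseSet.mem_nhds hbase] with x hx
  rw [ContinuousLinearMap.inCoordinates_eq hx hx]
  rfl

/-- The holomorphic section of `End E` attached to an endomorphism of the fibre at the base point
that commutes with `P`. -/
def spreadSection [LieGroup 𝓘(ℂ, Cn d) ω G] [IsManifold 𝓘(ℂ, Cn m) ω (G ⧸ P)]
    [ContMDiffVectorBundle ω (Cn r) E 𝓘(ℂ, Cn m)]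
    (hX : Manifold.IsSubmersion 𝓘(ℂ, Cn d) 𝓘(ℂ, Cn m) ω (fun g : G => (g : G ⧸ P)))
    {φ : Module.End ℂ (E ((1 : G) : G ⧸ P))}
    (hφ : ∀ (p : P) v, φ (A.isotropyMap p v) = A.isotropyMap p (φ v)) : A.invariantEnd where
  val := ⟨_, A.contMDiff_spread hX hφ⟩
  property g x v := A.spread_act hφ g x v

/-- Endomorphisms of `ℂ^r` that commute with the representation of `P`. -/
def repCommutant : Submodule ℂ (Module.End ℂ (Cn r)) where
  carrier := {φ | ∀ (p : P) v, φ (A.rep p v) = A.rep p (φ v)}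
  add_mem' hφ hψ p v := by simp [hφ p v, hψ p v]
  zero_mem' p v := by simp
  smul_mem' c φ hφ p v := by simp [hφ p v]

omit [∀ x, IsTopologicalAddGroup (E x)] [∀ x, ContinuousSMul ℂ (E x)] in
theorem rep_apply (p : P) (v : Cn r) :
    A.rep p v = fibreEquiv E (A.isotropyMap p ((fibreEquiv E).symm v)) :=
  rfl

theorem conj_mem_repCommutant (s : A.invariantEnd) :
    (fibreEquiv E).conj (s.1 ((1 : G) : G ⧸ P)).toLinearMap ∈ A.repCommutant := by
  intro p v
  simp only [LinearEquiv.conj_apply, LinearMap.comp_apply, LinearEquiv.coe_coe, rep_apply,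
    LinearEquiv.symm_apply_apply, ContinuousLinearMap.coe_coe]
  exact congrArg (fibreEquiv E) (apply_isotropyMap A (s := fun x => s.1 x) s.2 p _)

/-- The action of an invariant endomorphism of `E` on the fibre at the base point. -/
def evalBase : A.invariantEnd →ₗ[ℂ] A.repCommutant where
  toFun s := ⟨_, A.conj_mem_repCommutant s⟩
  map_add' s t := by
    ext v : 2
    simp [LinearEquiv.conj_apply]
  map_smul' c s := by
    ext v : 2
    simp [LinearEquiv.conj_apply]

theorem evalBase_apply (s : A.invariantEnd) (v : E ((1 : G) : G ⧸ P)) :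
    (A.evalBase s).1 (fibreEquiv E v) = fibreEquiv E (s.1 ((1 : G) : G ⧸ P) v) := by
  simp [evalBase, LinearEquiv.conj_apply]

/-- Invariant endomorphisms of `E` are the same as endomorphisms of the fibre at the base point
that commute with `P`. -/
def invariantEndEquiv [LieGroup 𝓘(ℂ, Cn d) ω G] [IsManifold 𝓘(ℂ, Cn m) ω (G ⧸ P)]
    [ContMDiffVectorBundle ω (Cn r) E 𝓘(ℂ, Cn m)]
    (hX : Manifold.IsSubmersion 𝓘(ℂ, Cn d) 𝓘(ℂ, Cn m) ω (fun g : G => (g : G ⧸ P))) :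
    A.invariantEnd ≃ₗ[ℂ] A.repCommutant :=
  LinearEquiv.ofBijective A.evalBase
    ⟨by
      rw [injective_iff_map_eq_zero]
      intro s hs
      have h0 : ∀ v, s.1 ((1 : G) : G ⧸ P) v = 0 := by
        intro v
        have h1 := A.evalBase_apply s v
        rw [hs] at h1
        exact (fibreEquiv E).map_eq_zero_iff.mp h1.symm
      apply Subtype.ext
      ext x v
      obtain ⟨g, rfl⟩ := QuotientGroup.mk_surjective x
      obtain ⟨u, rfl⟩ : ∃ u, A.fibreMap g u = v := ⟨_, A.fibreMap_fibreMapInv g v⟩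
      refine (apply_fibreMap A (s := fun x => s.1 x) s.2 g u).trans ?_
      rw [h0, map_zero]
      rfl, by
      rintro ⟨φ, hφ⟩
      have hφ' : ∀ (p : P) v, (fibreEquiv E).symm.conj φ (A.isotropyMap p v) =
          A.isotropyMap p ((fibreEquiv E).symm.conj φ v) := by
        intro p v
        have h1 := hφ p (fibreEquiv E v)
        simp only [rep_apply, LinearEquiv.symm_apply_apply] at h1
        simp only [LinearEquiv.conj_apply, LinearMap.comp_apply, LinearEquiv.coe_coe,
          LinearEquiv.symm_symm, h1, LinearEquiv.symm_apply_apply]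
      refine ⟨A.spreadSection hX hφ', Subtype.ext ?_⟩
      have h2 : (fibreEquiv E).conj (A.spread ((fibreEquiv E).symm.conj φ) ((1 : G) : G ⧸ P)) =
          φ := by
        rw [A.spread_one hφ']
        exact (fibreEquiv E).conj.apply_symm_apply φ
      exact h2⟩

end

end HomogeneousStructure

end

/-! ### Lowering operators and uniqueness of highest weight vectors, abstractly. -/

section

open Module

section HighestWeightVectors

variable {V : Type*} [AddCommGroup V] [Module ℂ V]

/-- The vectors obtained from `w` by applying at most `n` operators of `N`. -/
def loweringFiltration (N : Set (End ℂ V)) (w : V) : ℕ → Submodule ℂ V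
  | 0 => Submodule.span ℂ {w}
  | n + 1 => loweringFiltration N w n ⊔
      Submodule.span ℂ {v | ∃ y ∈ N, ∃ u ∈ loweringFiltration N w n, v = y u}

theorem loweringFiltration_mono (N : Set (End ℂ V)) (w : V) : Monotone (loweringFiltration N w) :=
  monotone_nat_of_le_succ fun _ => le_sup_left

theorem apply_mem_loweringFiltration {N : Set (End ℂ V)} {w : V} {y : End ℂ V} (hy : y ∈ N) {n : ℕ}
    {u : V} (hu : u ∈ loweringFiltration N w n) : y u ∈ loweringFiltration N w (n + 1) :=
  Submodule.mem_sup_right (Submodule.subset_span ⟨y, hy, u, hu, rfl⟩)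

theorem loweringFiltration_le {N : Set (End ℂ V)} {w : V} {U : Submodule ℂ V} (hw : w ∈ U)
    (hU : ∀ y ∈ N, ∀ u ∈ U, y u ∈ U) (n : ℕ) : loweringFiltration N w n ≤ U := by
  induction n with
  | zero => simpa [loweringFiltration] using hw
  | succ n ih =>
    refine sup_le ih (Submodule.span_le.mpr ?_)
    rintro _ ⟨y, hy, u, hu, rfl⟩
    exact hU y hy u (ih hu)

/-- Induction on `n`, moving `x` past the outermost lowering operator: `x (y u) = y (x u) + z u`.
The error term costs at most one lowering operator, which the level `n + 1` allows. -/
theorem apply_mem_loweringFiltration_of_raising {N B : Set (End ℂ V)}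
    (hNB : ∀ x ∈ B, ∀ y ∈ N, ∃ z ∈ N ∪ B, x * y = y * x + z) {w : V}
    (hw : ∀ x ∈ B, x w ∈ Submodule.span ℂ {w}) (n : ℕ) :
    ∀ x ∈ B, ∀ v ∈ loweringFiltration N w n, x v ∈ loweringFiltration N w n := by
  induction n with
  | zero =>
    intro x hx v hv
    obtain ⟨a, rfl⟩ := Submodule.mem_span_singleton.mp hv
    rw [map_smul]
    exact Submodule.smul_mem _ _ (hw x hx)
  | succ n ih =>
    intro x hx
    suffices h : loweringFiltration N w (n + 1) ≤ (loweringFiltration N w (n + 1)).comap x from h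
    refine sup_le (fun v hv => Submodule.mem_sup_left (ih x hx v hv)) (Submodule.span_le.mpr ?_)
    rintro _ ⟨y, hy, u, hu, rfl⟩
    obtain ⟨z, hz, hxy⟩ := hNB x hx y hy
    have h1 : x (y u) = y (x u) + z u := LinearMap.congr_fun hxy u
    change x (y u) ∈ loweringFiltration N w (n + 1)
    rw [h1]
    refine add_mem (apply_mem_loweringFiltration hy (ih x hx u hu)) ?_
    rcases hz with hz | hz
    · exact apply_mem_loweringFiltration hz hu
    · exact Submodule.mem_sup_left (ih z hz u hu)

/-- The space of the vectors of lower height. -/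
def lowerSpace (T : End ℂ V) (c : ℂ) : Submodule ℂ V :=
  ⨆ n : ℕ, T.eigenspace (c - (n + 1))

/-- Each operator of `N` lowers the eigenvalue of `T` by a positive integer, written `k + 1`. So
everything but the line of `w` lies at eigenvalues strictly below `c`. -/
theorem loweringFiltration_le_lowerSpace {N : Set (End ℂ V)} {T : End ℂ V} {c : ℂ} {w : V}
    (hw : T w = c • w) (hN : ∀ y ∈ N, ∃ k : ℕ, T * y = y * T - ((k : ℂ) + 1) • y) (n : ℕ) :
    loweringFiltration N w n ≤ Submodule.span ℂ {w} ⊔ lowerSpace T c := by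
  have key : ∀ y ∈ N, ∀ (a : ℂ) (v : V), T v = a • v → ∃ k : ℕ, T (y v) = (a - (k + 1)) • y v := by
    intro y hy a v hv
    obtain ⟨k, hk⟩ := hN y hy
    refine ⟨k, ?_⟩
    have h1 : T (y v) = y (T v) - ((k : ℂ) + 1) • y v := LinearMap.congr_fun hk v
    rw [h1, hv, map_smul, sub_smul]
  refine loweringFiltration_le (Submodule.mem_sup_left (Submodule.mem_span_singleton_self w)) ?_ n
  intro y hy
  suffices h : Submodule.span ℂ {w} ⊔ lowerSpace T c ≤ (lowerSpace T c).comap y from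
    fun u hu => Submodule.mem_sup_right (h hu)
  refine sup_le ?_ (iSup_le fun j v hv => ?_)
  · rw [Submodule.span_singleton_le_iff_mem, Submodule.mem_comap]
    obtain ⟨k, hk⟩ := key y hy c w hw
    exact Submodule.mem_iSup_of_mem k (End.mem_eigenspace_iff.mpr hk)
  · obtain ⟨k, hk⟩ := key y hy _ v (End.mem_eigenspace_iff.mp hv)
    -- The index comes from `(j + 1) + (k + 1) = (j + k + 1) + 1`.
    refine Submodule.mem_iSup_of_mem (j + k + 1) (End.mem_eigenspace_iff.mpr ?_)
    rw [hk]
    congr 1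
    push_cast
    ring

theorem lowerSpace_disjoint (T : End ℂ V) {c μ : ℂ} (h : ∀ n : ℕ, μ ≠ c - (n + 1)) :
    Disjoint (T.eigenspace μ) (lowerSpace T c) := by
  refine (T.eigenspaces_iSupIndep μ).mono_right (iSup_le fun n => ?_)
  exact le_iSup₂_of_le (c - (n + 1)) (h n).symm le_rfl

/-- If the eigenvalues differed, each would lie below the other by a positive integer. If they
agree, the component of `v` in the lower space is an eigenvector for `c` there, hence zero. -/
theorem mem_span_of_mem_sup_lowerSpace {T : End ℂ V} {c c' : ℂ} {v w : V} (hv0 : v ≠ 0)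
    (hw0 : w ≠ 0) (hv : T v = c' • v) (hw : T w = c • w)
    (hvw : v ∈ Submodule.span ℂ {w} ⊔ lowerSpace T c)
    (hwv : w ∈ Submodule.span ℂ {v} ⊔ lowerSpace T c') : v ∈ Submodule.span ℂ {w} := by
  have hlow : ∀ {c c' : ℂ} {v w : V}, v ≠ 0 → T v = c' • v → T w = c • w → c' ≠ c →
      v ∈ Submodule.span ℂ {w} ⊔ lowerSpace T c → ∃ n : ℕ, c' = c - (n + 1) := by
    intro c c' v w hv0 hv hw hc hvw
    by_contra! hn
    have h1 : Submodule.span ℂ {w} ⊔ lowerSpace T c ≤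
        ⨆ ν, ⨆ _ : ν ≠ c', T.eigenspace ν := by
      refine sup_le ?_ (iSup_le fun n => le_iSup₂_of_le (c - (n + 1)) (hn n).symm le_rfl)
      rw [Submodule.span_singleton_le_iff_mem]
      exact le_iSup₂_of_le (f := fun ν (_ : ν ≠ c') => T.eigenspace ν) c hc.symm le_rfl
        (End.mem_eigenspace_iff.mpr hw)
    exact hv0 (Submodule.disjoint_def.mp (T.eigenspaces_iSupIndep c') v
      (End.mem_eigenspace_iff.mpr hv) (h1 hvw))
  by_cases hc : c' = c
  · subst hc
    obtain ⟨u, hu, e, he, rfl⟩ := Submodule.mem_sup.mp hvw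
    have hu' : u ∈ T.eigenspace c' := by
      obtain ⟨a, rfl⟩ := Submodule.mem_span_singleton.mp hu
      exact Submodule.smul_mem _ _ (End.mem_eigenspace_iff.mpr hw)
    have he' : e ∈ T.eigenspace c' := by
      have := sub_mem (End.mem_eigenspace_iff.mpr hv) hu'
      rwa [add_sub_cancel_left] at this
    have hne : ∀ n : ℕ, c' ≠ c' - (n + 1) := by
      intro n h
      have h2 : ((n + 1 : ℕ) : ℂ) = 0 := by
        push_cast
        linear_combination h
      exact Nat.succ_ne_zero n (by exact_mod_cast h2)
    rw [Submodule.disjoint_def.mp (lowerSpace_disjoint T hne) e he' he, add_zero]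
    exact hu
  · obtain ⟨n, hn⟩ := hlow hv0 hv hw hc hvw
    obtain ⟨k, hk⟩ := hlow hw0 hw hv (Ne.symm hc) hwv
    exfalso
    have h2 : ((n + k + 2 : ℕ) : ℂ) = 0 := by
      push_cast
      linear_combination hn + hk
    exact absurd (Nat.cast_eq_zero.mp h2) (by omega)

end HighestWeightVectors

open LieAlgebra LieAlgebra.IsKilling

/-! ### Signs and heights of roots. -/

section Roots

variable {𝔤 : Type*} [LieRing 𝔤] [LieAlgebra ℂ 𝔤] [FiniteDimensional ℂ 𝔤] [IsKilling ℂ 𝔤]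
  {H : LieSubalgebra ℂ 𝔤} [H.IsCartanSubalgebra]

omit [FiniteDimensional ℂ 𝔤] [IsKilling ℂ 𝔤] in
theorem rootSum_induction {A : Set (Dual ℂ H)} {p : 𝔤 → Prop} {x : 𝔤}
    (hx : x ∈ rootSum (H := H) A) (mem : ∀ χ ∈ A, ∀ y ∈ rootSpace H (χ : H → ℂ), p y)
    (zero : p 0) (add : ∀ y z, p y → p z → p (y + z)) : p x := by
  unfold rootSum at hx
  induction hx using LieSubmodule.iSup_induction' with
  | zero => exact zero
  | add y z _ _ hy hz => exact add y z hy hz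
  | mem χ u hu =>
    by_cases hχ : χ ∈ A
    · exact mem χ hχ u (by simpa [hχ] using hu)
    · have : u = 0 := by simpa [hχ] using hu
      exact this ▸ zero

omit [FiniteDimensional ℂ 𝔤] [IsKilling ℂ 𝔤] in
theorem rootSpace_le_rootSum {A : Set (Dual ℂ H)} {χ : Dual ℂ H} (hχ : χ ∈ A) :
    rootSpace H (χ : H → ℂ) ≤ rootSum (H := H) A :=
  le_iSup₂_of_le (f := fun (χ : Dual ℂ H) (_ : χ ∈ A) => rootSpace H (χ : H → ℂ)) χ hχ le_rfl

omit [IsKilling ℂ 𝔤] in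
theorem mem_rootSpace_zero {x : 𝔤} :
    x ∈ rootSpace H ((0 : Dual ℂ H) : H → ℂ) ↔ x ∈ H := by
  have h1 : ((0 : Dual ℂ H) : H → ℂ) = 0 := rfl
  rw [h1]
  exact SetLike.ext_iff.mp (LieAlgebra.rootSpace_zero_eq ℂ 𝔤 H ) x

theorem lie_of_mem_rootSpace {χ : Dual ℂ H} {y : 𝔤} (hy : y ∈ rootSpace H (χ : H → ℂ)) (h : H) :
    ⁅(h : 𝔤), y⁆ = χ h • y :=
  lie_eq_smul_of_mem_rootSpace hy h

theorem pos_or_neg_of_rootSpace_ne_bot (b : (rootSystem H).Base) {χ : Dual ℂ H}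
    (h : rootSpace H (χ : H → ℂ) ≠ ⊥) : χ ∈ posCone b ∨ -χ ∈ posCone b := by
  by_cases hne : χ = 0
  · exact Or.inl (hne ▸ zero_mem _)
  let α : LieModule.Weight ℂ H 𝔤 := ⟨(χ : H → ℂ), h⟩
  have hα : α ∈ H.root := by
    simp only [LieSubalgebra.root, Finset.mem_filter, Finset.mem_univ, true_and]
    intro h0
    apply hne
    ext x
    exact congrFun h0 x
  have hroot : (rootSystem H).root ⟨α, hα⟩ = χ := by
    ext x
    rfl
  have hrange : (rootSystem H).root '' (b.support : Set H.root) =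
      Set.range fun i : b.support => (rootSystem H).root i := by
    ext x
    simp
  have := b.root_mem_or_neg_mem ⟨α, hα⟩
  rwa [hroot, hrange] at this

/-- There is an element of the Cartan subalgebra that measures the height of the roots. -/
theorem exists_height (b : (rootSystem H).Base) :
    ∃ h : H, ∀ χ ∈ posCone b, ∃ n : ℕ, χ h = n ∧ (n = 0 → χ = 0) := by
  obtain ⟨f, hf⟩ : ∃ f : Dual ℂ H →ₗ[ℂ] ℂ, ∀ i : b.support, f ((rootSystem H).root i) = 1 := by
    have hli : LinearIndependent ℂ (fun i : b.support => (rootSystem H).root i) :=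
      b.linearIndepOn_root
    obtain ⟨f, hf⟩ := ((Basis.span hli).constr ℂ (fun _ : b.support => (1 : ℂ))).exists_extend
    refine ⟨f, fun i => ?_⟩
    have h1 := LinearMap.congr_fun hf (Basis.span hli i)
    rw [Basis.constr_basis] at h1
    rw [← h1, LinearMap.comp_apply, Submodule.subtype_apply, Basis.span_apply]
  -- By reflexivity, the functional equal to `1` on all simple roots is evaluation at an element of
  -- `H`.
  refine ⟨(evalEquiv ℂ H).symm f, fun χ hχ => ?_⟩
  have hev : ∀ χ : Dual ℂ H, χ ((evalEquiv ℂ H).symm f) = f χ := fun χ =>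
    apply_evalEquiv_symm_apply ℂ H χ f
  rw [hev]
  induction hχ using AddSubmonoid.closure_induction with
  | mem x hx =>
    obtain ⟨i, rfl⟩ := hx
    exact ⟨1, by rw [hf, Nat.cast_one], by simp⟩
  | zero => exact ⟨0, by simp, fun _ => rfl⟩
  | add _ _ _ _ h1 h2 =>
    obtain ⟨m, hm, hm'⟩ := h1
    obtain ⟨n, hn, hn'⟩ := h2
    exact ⟨m + n, by simp [hm, hn], fun h => by rw [hm' (by omega), hn' (by omega), add_zero]⟩

end Roots

end

/-! ### Highest weight theory for the reductive part of a parabolic subalgebra. -/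

section

open LieAlgebra LieAlgebra.IsKilling Module

section ParabolicRep

variable {𝔤 : Type*} [LieRing 𝔤] [LieAlgebra ℂ 𝔤] [FiniteDimensional ℂ 𝔤] [IsKilling ℂ 𝔤]
  {H : LieSubalgebra ℂ 𝔤} [H.IsCartanSubalgebra]
  {b : (rootSystem H).Base} {S : Set b.support}

omit [FiniteDimensional ℂ 𝔤] [IsKilling ℂ 𝔤] in
theorem rootSum_mono {A B : Set (Dual ℂ H)} (h : A ⊆ B) : rootSum (H := H) A ≤ rootSum B :=
  biSup_mono h

theorem mem_levi_iff {x : 𝔤} : x ∈ levi b S ↔ x ∈ rootSum (H := H) (leviLattice b S) :=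
  Iff.rfl

theorem mem_parabolic_iff {x : 𝔤} : x ∈ parabolic b S ↔
    x ∈ rootSum (H := H) ((posCone b : Set (Dual ℂ H)) ∪ leviLattice b S) :=
  Iff.rfl

theorem mem_parabolic_of_mem_levi {x : 𝔤} (hx : x ∈ levi b S) : x ∈ parabolic b S :=
  rootSum_mono Set.subset_union_right hx

theorem mem_parabolic_of_mem_nilrad {x : 𝔤} (hx : x ∈ nilrad b S) : x ∈ parabolic b S :=
  rootSum_mono (Set.sdiff_subset.trans Set.subset_union_left) hx

theorem mem_levi_of_mem_rootSpace {χ : Dual ℂ H} (hχ : χ ∈ leviLattice b S) {x : 𝔤}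
    (hx : x ∈ rootSpace H (χ : H → ℂ)) : x ∈ levi b S :=
  rootSpace_le_rootSum (A := (leviLattice b S : Set (Dual ℂ H))) hχ hx

theorem mem_levi_of_mem_cartan {x : 𝔤} (hx : x ∈ H) : x ∈ levi b S :=
  mem_levi_of_mem_rootSpace (zero_mem _) (mem_rootSpace_zero.mpr hx)

/-- `𝔭 = 𝔯 + 𝔫`. -/
theorem exists_add_of_mem_parabolic {x : 𝔤} (hx : x ∈ parabolic b S) :
    ∃ y ∈ levi b S, ∃ z ∈ nilrad b S, x = y + z := by
  refine rootSum_induction (mem_parabolic_iff.mp hx)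
    (p := fun x => ∃ y ∈ levi b S, ∃ z ∈ nilrad b S, x = y + z) ?_ ?_ ?_
  · intro χ hχ u hu
    by_cases hL : χ ∈ leviLattice b S
    · exact ⟨u, mem_levi_of_mem_rootSpace hL hu, 0, zero_mem _, (add_zero u).symm⟩
    · refine ⟨0, zero_mem _, u, rootSpace_le_rootSum ?_ hu, (zero_add u).symm⟩
      exact ⟨hχ.resolve_right hL, hL⟩
  · exact ⟨0, zero_mem _, 0, zero_mem _, (add_zero 0).symm⟩
  · rintro _ _ ⟨y, hy, z, hz, rfl⟩ ⟨y', hy', z', hz', rfl⟩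
    exact ⟨y + y', add_mem hy hy', z + z', add_mem hz hz', by abel⟩

variable {V : Type*} [AddCommGroup V] [Module ℂ V] (τ : parabolic b S →ₗ[ℂ] End ℂ V)

/-- `τ` is compatible with the Lie bracket. -/
def IsLieRep : Prop :=
  ∀ x y z : parabolic b S, (z : 𝔤) = ⁅(x : 𝔤), (y : 𝔤)⁆ → τ z = τ x * τ y - τ y * τ x

/-- The action of the negative root vectors of `𝔯`. -/
def negativeOperators : Set (End ℂ V) :=
  {T | ∃ χ ∈ leviLattice b S, -χ ∈ posCone b ∧ χ ≠ 0 ∧ ∃ x : parabolic b S,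
    (x : 𝔤) ∈ rootSpace H (χ : H → ℂ) ∧ T = τ x}

/-- The action of the positive root vectors of `𝔯` and of `𝔥`. -/
def borelOperators : Set (End ℂ V) :=
  {T | ∃ χ ∈ leviLattice b S, χ ∈ posCone b ∧ ∃ x : parabolic b S,
    (x : 𝔤) ∈ rootSpace H (χ : H → ℂ) ∧ T = τ x}

variable {τ}

/-- The algebra `𝔯` is spanned by its root spaces, and every root is positive or negative. The
Cartan subalgebra is covered by the Borel operators, since `0` lies in `posCone b`. -/
theorem isLeviStable_of_operators {U : Submodule ℂ V}
    (hN : ∀ y ∈ negativeOperators τ, ∀ u ∈ U, y u ∈ U)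
    (hB : ∀ y ∈ borelOperators τ, ∀ u ∈ U, y u ∈ U) : IsLeviStable τ U := by
  rintro ⟨x, hx⟩ hxl u hu
  obtain ⟨hx', h⟩ : ∃ hx : x ∈ parabolic b S, ∀ u ∈ U, τ ⟨x, hx⟩ u ∈ U := by
    refine rootSum_induction (mem_levi_iff.mp hxl)
      (p := fun x => ∃ hx : x ∈ parabolic b S, ∀ u ∈ U, τ ⟨x, hx⟩ u ∈ U) ?_ ?_ ?_
    · intro χ hχ y hy
      refine ⟨mem_parabolic_of_mem_levi (mem_levi_of_mem_rootSpace hχ hy), fun u hu => ?_⟩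
      by_cases h0 : rootSpace H (χ : H → ℂ) = ⊥
      · rw [h0, LieSubmodule.mem_bot] at hy
        subst hy
        have h1 : (⟨0, mem_parabolic_of_mem_levi (zero_mem _)⟩ : parabolic b S) = 0 := rfl
        rw [h1, map_zero]
        exact zero_mem _
      · by_cases hp : χ ∈ posCone b
        · exact hB _ ⟨χ, hχ, hp, _, hy, rfl⟩ u hu
        · have hn := (pos_or_neg_of_rootSpace_ne_bot b h0).resolve_left hp
          exact hN _ ⟨χ, hχ, hn, fun h => hp (h ▸ zero_mem _), _, hy, rfl⟩ u hu
    · refine ⟨zero_mem _, fun u _ => ?_⟩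
      have h1 : (⟨0, zero_mem _⟩ : parabolic b S) = 0 := rfl
      rw [h1, map_zero]
      exact zero_mem _
    · rintro y z ⟨hy, hy'⟩ ⟨hz, hz'⟩
      refine ⟨add_mem hy hz, fun u hu => ?_⟩
      have h1 : (⟨y + z, add_mem hy hz⟩ : parabolic b S) = ⟨y, hy⟩ + ⟨z, hz⟩ := rfl
      rw [h1, map_add]
      exact add_mem (hy' u hu) (hz' u hu)
  exact h u hu

theorem operators_stable {W : Submodule ℂ V} (hW : IsLeviStable τ W) :
    ∀ y ∈ negativeOperators τ, ∀ u ∈ W, y u ∈ W := by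
  rintro _ ⟨χ, hχ, -, -, x, hx, rfl⟩ u hu
  exact hW x (mem_levi_of_mem_rootSpace hχ hx) u hu

theorem borelOperators_comm (hτ : IsLieRep τ) : ∀ x ∈ borelOperators τ, ∀ y ∈ negativeOperators τ,
    ∃ z ∈ negativeOperators τ ∪ borelOperators τ, x * y = y * x + z := by
  rintro _ ⟨χ, hχ, hχp, x, hx, rfl⟩ _ ⟨ψ, hψ, hψn, hψ0, y, hy, rfl⟩
  have hmem : ⁅(x : 𝔤), (y : 𝔤)⁆ ∈ rootSpace H ((χ + ψ : Dual ℂ H) : H → ℂ) :=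
    lie_mem_genWeightSpace_of_mem_genWeightSpace hx hy
  have hL : χ + ψ ∈ leviLattice b S := add_mem hχ hψ
  let z : parabolic b S :=
    ⟨⁅(x : 𝔤), (y : 𝔤)⁆, mem_parabolic_of_mem_levi (mem_levi_of_mem_rootSpace hL hmem)⟩
  refine ⟨τ z, ?_, ?_⟩
  · by_cases h0 : rootSpace H ((χ + ψ : Dual ℂ H) : H → ℂ) = ⊥
    · rw [h0, LieSubmodule.mem_bot] at hmem
      -- A vanishing bracket lies in every root space and is filed under weight `0`.
      refine Or.inr ⟨0, zero_mem _, zero_mem _, z, ?_, rfl⟩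
      change ⁅(x : 𝔤), (y : 𝔤)⁆ ∈ _
      rw [hmem]
      exact zero_mem _
    · by_cases hp : χ + ψ ∈ posCone b
      · exact Or.inr ⟨_, hL, hp, z, hmem, rfl⟩
      · exact Or.inl ⟨_, hL, (pos_or_neg_of_rootSpace_ne_bot b h0).resolve_left hp,
          fun h => hp (h ▸ zero_mem _), z, hmem, rfl⟩
  · rw [hτ x y z rfl]
    abel

theorem borelOperators_apply {lam : Dual ℂ H} {w : V} (hw : w ∈ multiplicitySpace τ lam) :
    ∀ x ∈ borelOperators τ, x w ∈ Submodule.span ℂ {w} := by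
  rintro _ ⟨χ, hχ, hχp, x, hx, rfl⟩
  by_cases h0 : χ = 0
  · subst h0
    rw [hw.1 x (mem_rootSpace_zero.mp hx)]
    exact Submodule.smul_mem _ _ (Submodule.mem_span_singleton_self w)
  · rw [hw.2 χ hχp hχ h0 x hx]
    exact zero_mem _

/-- The union of the filtration is stable under the lowering operators by construction and under the
Borel operators by commutation. It is a non-zero `𝔯`-submodule of the irreducible `W`, so it is all
of `W`. -/
theorem iSup_loweringFiltration_eq (hτ : IsLieRep τ) {W : Submodule ℂ V} (hW : IsLeviStable τ W)
    (hirr : ∀ W' ≤ W, IsLeviStable τ W' → W' = ⊥ ∨ W' = W) {lam : Dual ℂ H} {w : V}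
    (hwW : w ∈ W) (hw0 : w ≠ 0) (hw : w ∈ multiplicitySpace τ lam) :
    ⨆ n, loweringFiltration (negativeOperators τ) w n = W := by
  have hmem : ∀ v, v ∈ ⨆ n, loweringFiltration (negativeOperators τ) w n ↔
      ∃ n, v ∈ loweringFiltration (negativeOperators τ) w n := fun v =>
    Submodule.mem_iSup_of_directed _ (loweringFiltration_mono _ w).directed_le
  have hle : ⨆ n, loweringFiltration (negativeOperators τ) w n ≤ W :=
    iSup_le fun n => loweringFiltration_le hwW (operators_stable hW) n
  refine (hirr _ hle ?_).resolve_left ?_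
  · refine isLeviStable_of_operators ?_ ?_
    · intro y hy u hu
      obtain ⟨n, hn⟩ := (hmem u).mp hu
      exact (hmem _).mpr ⟨n + 1, apply_mem_loweringFiltration hy hn⟩
    · intro y hy u hu
      obtain ⟨n, hn⟩ := (hmem u).mp hu
      exact (hmem _).mpr ⟨n, apply_mem_loweringFiltration_of_raising (borelOperators_comm hτ)
        (borelOperators_apply hw) n y hy u hn⟩
  · intro h0
    refine hw0 ((Submodule.mem_bot ℂ).mp (h0 ▸ (hmem w).mpr ⟨0, ?_⟩))
    exact Submodule.mem_span_singleton_self w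

/-- Highest weight vectors of an irreducible `𝔯`-module are unique up to scalars. -/
theorem mem_span_of_highest (hτ : IsLieRep τ) {W : Submodule ℂ V} (hW : IsLeviStable τ W)
    (hirr : ∀ W' ≤ W, IsLeviStable τ W' → W' = ⊥ ∨ W' = W) {lam mu : Dual ℂ H} {w v : V}
    (hwW : w ∈ W) (hw0 : w ≠ 0) (hw : w ∈ multiplicitySpace τ lam)
    (hvW : v ∈ W) (hv0 : v ≠ 0) (hv : v ∈ multiplicitySpace τ mu) :
    v ∈ Submodule.span ℂ {w} := by
  obtain ⟨h, hh⟩ := exists_height b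
  let hp : parabolic b S := ⟨h, mem_parabolic_of_mem_levi (mem_levi_of_mem_cartan h.2)⟩
  have hlow : ∀ y ∈ negativeOperators τ, ∃ k : ℕ, τ hp * y = y * τ hp - ((k : ℂ) + 1) • y := by
    rintro _ ⟨χ, hχ, hχn, hχ0, x, hx, rfl⟩
    obtain ⟨n, hn, hn0⟩ := hh _ hχn
    obtain ⟨k, rfl⟩ : ∃ k, n = k + 1 :=
      Nat.exists_eq_succ_of_ne_zero fun h0 => hχ0 (neg_eq_zero.mp (hn0 h0))
    refine ⟨k, ?_⟩
    have h1 : ((χ h • x : parabolic b S) : 𝔤) = ⁅(hp : 𝔤), (x : 𝔤)⁆ :=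
      (lie_of_mem_rootSpace hx h).symm
    have h2 := hτ hp x _ h1
    have h3 : χ h = -((k : ℂ) + 1) := by
      have : (-χ) h = -(χ h) := rfl
      rw [this] at hn
      push_cast at hn
      linear_combination -hn
    rw [map_smul, h3, neg_smul] at h2
    rw [sub_eq_add_neg, h2]
    abel
  -- Seen from any of its highest weight vectors, `W` consists of that line and strictly lower
  -- heights. Applying this to both `v` and `w` forces them to be proportional.
  have hle : ∀ {mu : Dual ℂ H} {v : V}, v ∈ W → v ≠ 0 → v ∈ multiplicitySpace τ mu →
      W ≤ Submodule.span ℂ {v} ⊔ lowerSpace (τ hp) (mu h) := by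
    intro mu v hvW hv0 hv
    rw [← iSup_loweringFiltration_eq hτ hW hirr hvW hv0 hv]
    exact iSup_le fun n => loweringFiltration_le_lowerSpace (hv.1 hp h.2) hlow n
  exact mem_span_of_mem_sup_lowerSpace hv0 hw0 (hv.1 hp h.2) (hw.1 hp h.2)
    (hle hwW hw0 hw hvW) (hle hvW hv0 hv hwW)

theorem weight_eq_of_highest (hτ : IsLieRep τ) {W : Submodule ℂ V} (hW : IsLeviStable τ W)
    (hirr : ∀ W' ≤ W, IsLeviStable τ W' → W' = ⊥ ∨ W' = W) {lam mu : Dual ℂ H} {w v : V}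
    (hwW : w ∈ W) (hw0 : w ≠ 0) (hw : w ∈ multiplicitySpace τ lam)
    (hvW : v ∈ W) (hv0 : v ≠ 0) (hv : v ∈ multiplicitySpace τ mu) : mu = lam := by
  have hspan := mem_span_of_highest hτ hW hirr hwW hw0 hw hvW hv0 hv
  have hv' : v ∈ multiplicitySpace τ lam := by
    obtain ⟨a, rfl⟩ := Submodule.mem_span_singleton.mp hspan
    exact Submodule.smul_mem _ _ hw
  ext x
  have hx : (x : 𝔤) ∈ parabolic b S := mem_parabolic_of_mem_levi (mem_levi_of_mem_cartan x.2)
  have h1 : mu x • v = lam x • v := (hv.1 ⟨x, hx⟩ x.2).symm.trans (hv'.1 ⟨x, hx⟩ x.2)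
  exact smul_left_injective ℂ hv0 h1

end ParabolicRep

end

/-! ### Multiplicity free representations: isotypic components and commutant. -/

section

open LieAlgebra LieAlgebra.IsKilling Module

section Internal

variable {V : Type*} [AddCommGroup V] [Module ℂ V] {ι : Type*} [DecidableEq ι]
  {W : ι → Submodule ℂ V}

theorem linearMap_ext_of_isInternal (hint : DirectSum.IsInternal W) {V' : Type*} [AddCommGroup V']
    [Module ℂ V'] {f g : V →ₗ[ℂ] V'} (h : ∀ i, ∀ v ∈ W i, f v = g v) : f = g := by
  ext v
  have hv : v ∈ ⨆ i, W i := hint.submodule_iSup_eq_top ▸ Submodule.mem_top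
  induction hv using Submodule.iSup_induction' with
  | mem i x hx => exact h i x hx
  | zero => simp
  | add x y _ _ hx hy => rw [map_add, map_add, hx, hy]

/-- The projection of a direct sum to a summand. -/
def componentProj (hint : DirectSum.IsInternal W) (i : ι) : End ℂ V :=
  (W i).subtype ∘ₗ DirectSum.component ℂ ι (fun i => W i) i ∘ₗ
    (LinearEquiv.ofBijective (DirectSum.coeLinearMap W) hint).symm.toLinearMap

variable (hint : DirectSum.IsInternal W)

theorem componentProj_mem (i : ι) (v : V) : componentProj hint i v ∈ W i :=
  Subtype.property _

theorem ofBijective_symm_apply {i : ι} {v : V} (hv : v ∈ W i) :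
    (LinearEquiv.ofBijective (DirectSum.coeLinearMap W) hint).symm v =
      DirectSum.lof ℂ ι (fun i => W i) i ⟨v, hv⟩ := by
  rw [LinearEquiv.symm_apply_eq]
  exact (DirectSum.coeLinearMap_lof W i ⟨v, hv⟩).symm

theorem componentProj_self {i : ι} {v : V} (hv : v ∈ W i) : componentProj hint i v = v := by
  simp [componentProj, ofBijective_symm_apply hint hv, DirectSum.component.lof_self]

theorem componentProj_of_ne {i j : ι} (hij : i ≠ j) {v : V} (hv : v ∈ W i) :
    componentProj hint j v = 0 := by
  simp [componentProj, ofBijective_symm_apply hint hv, DirectSum.component.of, hij]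

theorem sum_componentProj [Fintype ι] (v : V) : ∑ i, componentProj hint i v = v := by
  have h : ∑ i, componentProj hint i = LinearMap.id := by
    refine linearMap_ext_of_isInternal hint fun i v hv => ?_
    rw [LinearMap.sum_apply, Finset.sum_eq_single i]
    · exact componentProj_self hint hv
    · intro j _ hj
      exact componentProj_of_ne hint hj.symm hv
    · simp
  simpa using LinearMap.congr_fun h v

theorem componentProj_comm {T : End ℂ V} (hT : ∀ i, ∀ v ∈ W i, T v ∈ W i) (j : ι) (v : V) :
    componentProj hint j (T v) = T (componentProj hint j v) := by
  have h : componentProj hint j ∘ₗ T = T ∘ₗ componentProj hint j := by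
    refine linearMap_ext_of_isInternal hint fun i v hv => ?_
    rw [LinearMap.comp_apply, LinearMap.comp_apply]
    by_cases hij : i = j
    · subst hij
      rw [componentProj_self hint hv, componentProj_self hint (hT i v hv)]
    · rw [componentProj_of_ne hint hij hv, componentProj_of_ne hint hij (hT i v hv), map_zero]
  exact LinearMap.congr_fun h v

theorem mem_of_componentProj_eq_zero [Fintype ι] {i : ι} {v : V}
    (h : ∀ j, j ≠ i → componentProj hint j v = 0) : v ∈ W i := by
  rw [← sum_componentProj hint v, Finset.sum_eq_single i (fun j _ hj => h j hj) (by simp)]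
  exact componentProj_mem hint i v

theorem componentProj_eq_zero_iff [Fintype ι] {j : ι} {v : V} :
    componentProj hint j v = 0 ↔ v ∈ ⨆ k, ⨆ _ : k ≠ j, W k := by
  constructor
  · intro h
    rw [← sum_componentProj hint v]
    refine sum_mem fun k _ => ?_
    by_cases hk : k = j
    · rw [hk, h]
      exact zero_mem _
    · exact Submodule.mem_iSup_of_mem k (Submodule.mem_iSup_of_mem hk (componentProj_mem hint k v))
  · intro h
    have : ⨆ k, ⨆ _ : k ≠ j, W k ≤ LinearMap.ker (componentProj hint j) :=
      iSup₂_le fun k hk u hu => componentProj_of_ne hint hk hu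
    exact this h

end Internal

section MultiplicityFree

variable {𝔤 : Type*} [LieRing 𝔤] [LieAlgebra ℂ 𝔤] [FiniteDimensional ℂ 𝔤] [IsKilling ℂ 𝔤]
  {H : LieSubalgebra ℂ 𝔤} [H.IsCartanSubalgebra]
  {b : (rootSystem H).Base} {S : Set b.support}
  {V : Type*} [AddCommGroup V] [Module ℂ V] {τ : parabolic b S →ₗ[ℂ] End ℂ V}
  {ι : Type*} [DecidableEq ι] {lam : ι → Dual ℂ H} {W : ι → Submodule ℂ V}

theorem componentProj_mem_multiplicitySpace (hW : ∀ i, IsLeviStable τ (W i))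
    (hint : DirectSum.IsInternal W) {mu : Dual ℂ H} {v : V} (hv : v ∈ multiplicitySpace τ mu)
    (j : ι) : componentProj hint j v ∈ multiplicitySpace τ mu := by
  have hcomm : ∀ x : parabolic b S, (x : 𝔤) ∈ levi b S → ∀ v,
      componentProj hint j (τ x v) = τ x (componentProj hint j v) := fun x hx v =>
    componentProj_comm hint (fun i v hv => hW i x hx v hv) j v
  refine ⟨fun x hx => ?_, fun χ h1 h2 h3 x hx => ?_⟩
  · rw [← hcomm x (mem_levi_of_mem_cartan hx), hv.1 x hx, map_smul]
  · rw [← hcomm x (mem_levi_of_mem_rootSpace h2 hx), hv.2 χ h1 h2 h3 x hx, map_zero]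

/-- The projection commutes with `𝔯`, so a non-zero component in `W j` is again a highest weight
vector of weight `mu`; but `W j` has only the highest weight `lam j`. -/
theorem weight_eq_of_componentProj_ne_zero (hτ : IsLieRep τ)
    (hW : ∀ i, IsIrredOfWeight τ (lam i) (W i)) (hint : DirectSum.IsInternal W) {mu : Dual ℂ H}
    {v : V} (hv : v ∈ multiplicitySpace τ mu) {j : ι} (hj : componentProj hint j v ≠ 0) :
    mu = lam j := by
  obtain ⟨w, hwW, hw0, hw⟩ := (hW j).exists_highest
  exact weight_eq_of_highest hτ (hW j).stable (hW j).irreducible hwW hw0 hw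
    (componentProj_mem hint j v) hj
    (componentProj_mem_multiplicitySpace (fun i => (hW i).stable) hint hv j)

variable [Fintype ι]

theorem exists_of_multiplicitySpace_ne_bot (hτ : IsLieRep τ)
    (hW : ∀ i, IsIrredOfWeight τ (lam i) (W i)) (hint : DirectSum.IsInternal W) {mu : Dual ℂ H}
    (h : multiplicitySpace τ mu ≠ ⊥) : ∃ i, lam i = mu := by
  obtain ⟨v, hv, hv0⟩ := Submodule.exists_mem_ne_zero_of_ne_bot h
  by_contra! hne
  refine hv0 ?_
  rw [← sum_componentProj hint v]
  refine Finset.sum_eq_zero fun j _ => ?_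
  by_contra hj
  exact hne j (weight_eq_of_componentProj_ne_zero hτ hW hint hv hj).symm

omit [DecidableEq ι] [Fintype ι] in
theorem multiplicitySpace_ne_bot (hW : ∀ i, IsIrredOfWeight τ (lam i) (W i)) (i : ι) :
    multiplicitySpace τ (lam i) ≠ ⊥ := by
  obtain ⟨w, -, hw0, hw⟩ := (hW i).exists_highest
  exact fun h => hw0 ((Submodule.mem_bot ℂ).mp (h ▸ hw))

/-- Distinctness of the weights enters here: a component in another summand would give that summand
the same highest weight. -/
theorem multiplicitySpace_le (hτ : IsLieRep τ) (hlam : Function.Injective lam)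
    (hW : ∀ i, IsIrredOfWeight τ (lam i) (W i)) (hint : DirectSum.IsInternal W) (i : ι) :
    multiplicitySpace τ (lam i) ≤ W i := by
  intro v hv
  refine mem_of_componentProj_eq_zero hint fun j hj => ?_
  by_contra h
  exact hj (hlam (weight_eq_of_componentProj_ne_zero hτ hW hint hv h)).symm

theorem isLeviStable_inf {U U' : Submodule ℂ V} (h : IsLeviStable τ U) (h' : IsLeviStable τ U') :
    IsLeviStable τ (U ⊓ U') :=
  fun x hx w hw => ⟨h x hx w hw.1, h' x hx w hw.2⟩

/-- Both irreducible submodules contain the highest weight vector of `U`, so their intersection is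
non-zero and equals each of them. -/
theorem eq_of_isIrredOfWeight (hτ : IsLieRep τ) (hlam : Function.Injective lam)
    (hW : ∀ i, IsIrredOfWeight τ (lam i) (W i)) (hint : DirectSum.IsInternal W) {i : ι}
    {U : Submodule ℂ V} (hU : IsIrredOfWeight τ (lam i) U) : U = W i := by
  obtain ⟨w, hwU, hw0, hw⟩ := hU.exists_highest
  have hwW : w ∈ W i := multiplicitySpace_le hτ hlam hW hint i hw
  have hst := isLeviStable_inf hU.stable (hW i).stable
  have hne : U ⊓ W i ≠ ⊥ := fun h => hw0 ((Submodule.mem_bot ℂ).mp (h ▸ ⟨hwU, hwW⟩))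
  rw [← (hU.irreducible _ inf_le_left hst).resolve_left hne]
  exact ((hW i).irreducible _ inf_le_right hst).resolve_left hne

theorem isotypic_eq (hτ : IsLieRep τ) (hlam : Function.Injective lam)
    (hW : ∀ i, IsIrredOfWeight τ (lam i) (W i)) (hint : DirectSum.IsInternal W) (i : ι) :
    isotypic τ (lam i) = W i :=
  le_antisymm (sSup_le fun _ hU => (eq_of_isIrredOfWeight hτ hlam hW hint hU).le)
    (le_sSup (hW i))

theorem isotypic_eq_bot (hτ : IsLieRep τ)
    (hW : ∀ i, IsIrredOfWeight τ (lam i) (W i)) (hint : DirectSum.IsInternal W) {mu : Dual ℂ H}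
    (hmu : ∀ i, lam i ≠ mu) : isotypic τ mu = ⊥ := by
  refine sSup_eq_bot.mpr fun U hU => ?_
  exfalso
  obtain ⟨w, -, hw0, hw⟩ := hU.exists_highest
  obtain ⟨i, hi⟩ := exists_of_multiplicitySpace_ne_bot hτ hW hint (mu := mu)
    fun h => hw0 ((Submodule.mem_bot ℂ).mp (h ▸ hw))
  exact hmu i hi

theorem iSup_isotypic_eq (hτ : IsLieRep τ) (hlam : Function.Injective lam)
    (hW : ∀ i, IsIrredOfWeight τ (lam i) (W i)) (hint : DirectSum.IsInternal W) (j : ι) :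
    ⨆ ν : {ν : Dual ℂ H // ν ≠ lam j}, isotypic τ ν.1 = ⨆ k, ⨆ _ : k ≠ j, W k := by
  refine le_antisymm (iSup_le ?_) (iSup₂_le fun k hk => ?_)
  · rintro ⟨ν, hν⟩
    by_cases h : ∃ k, lam k = ν
    · obtain ⟨k, rfl⟩ := h
      rw [isotypic_eq hτ hlam hW hint]
      exact le_iSup₂_of_le (f := fun k (_ : k ≠ j) => W k) k (fun h => hν (h ▸ rfl)) le_rfl
    · push Not at h
      rw [isotypic_eq_bot hτ hW hint h]
      exact bot_le
  · refine le_iSup_of_le (⟨lam k, fun h => hk (hlam h)⟩ : {ν : Dual ℂ H // ν ≠ lam j}) ?_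
    rw [isotypic_eq hτ hlam hW hint]

theorem arrowNonzero_iff (hτ : IsLieRep τ) (hlam : Function.Injective lam)
    (hW : ∀ i, IsIrredOfWeight τ (lam i) (W i)) (hint : DirectSum.IsInternal W) {i j : ι} :
    ArrowNonzero τ (lam i) (lam j) ↔ ∃ x : parabolic b S, (x : 𝔤) ∈ nilrad b S ∧ ∃ v ∈ W i,
      componentProj hint j (τ x v) ≠ 0 := by
  unfold ArrowNonzero
  rw [isotypic_eq hτ hlam hW hint, iSup_isotypic_eq hτ hlam hW hint]
  simp only [ne_eq, componentProj_eq_zero_iff]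

/-- An endomorphism that commutes with `𝔯` is a scalar on each irreducible component. -/
theorem exists_scalars (hτ : IsLieRep τ) (hlam : Function.Injective lam)
    (hW : ∀ i, IsIrredOfWeight τ (lam i) (W i)) (hint : DirectSum.IsInternal W) {φ : End ℂ V}
    (hφ : ∀ x : parabolic b S, (x : 𝔤) ∈ levi b S → ∀ v, φ (τ x v) = τ x (φ v)) (i : ι) :
    ∃ c : ℂ, ∀ v ∈ W i, φ v = c • v := by
  obtain ⟨w, hwW, hw0, hw⟩ := (hW i).exists_highest
  have hφw : φ w ∈ multiplicitySpace τ (lam i) := by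
    refine ⟨fun x hx => ?_, fun χ h1 h2 h3 x hx => ?_⟩
    · rw [← hφ x (mem_levi_of_mem_cartan hx), hw.1 x hx, map_smul]
    · rw [← hφ x (mem_levi_of_mem_rootSpace h2 hx), hw.2 χ h1 h2 h3 x hx, map_zero]
  have hspan : φ w ∈ Submodule.span ℂ {w} := by
    by_cases h0 : φ w = 0
    · rw [h0]
      exact zero_mem _
    · exact mem_span_of_highest hτ (hW i).stable (hW i).irreducible hwW hw0 hw
        (multiplicitySpace_le hτ hlam hW hint i hφw) h0 hφw
  obtain ⟨c, hc⟩ := Submodule.mem_span_singleton.mp hspan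
  refine ⟨c, fun v hv => ?_⟩
  -- This kernel is an `𝔯`-submodule that contains the highest weight vector, so it contains the
  -- irreducible `W i`.
  have hst : IsLeviStable τ (LinearMap.ker (φ - c • LinearMap.id)) := by
    intro x hx u hu
    simp only [LinearMap.mem_ker, LinearMap.sub_apply, LinearMap.smul_apply, LinearMap.id_apply,
      sub_eq_zero] at hu ⊢
    rw [hφ x hx, hu, map_smul]
  have h1 := ((hW i).irreducible _ inf_le_left
    (isLeviStable_inf (hW i).stable hst)).resolve_left fun h =>
    hw0 ((Submodule.mem_bot ℂ).mp (h ▸ ⟨hwW, by simp [hc]⟩))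
  have h2 := (h1.ge hv).2
  simpa [sub_eq_zero] using h2

variable (τ) in
/-- The endomorphisms of `V` that commute with `𝔭`. -/
def commutant : Submodule ℂ (End ℂ V) where
  carrier := {φ | ∀ x v, φ (τ x v) = τ x (φ v)}
  add_mem' hφ hψ x v := by simp [hφ x v, hψ x v]
  zero_mem' x v := by simp
  smul_mem' c φ hφ x v := by simp [hφ x v]

/-- The functions that are constant along a relation. -/
def constantAlong {X : Type*} (R : X → X → Prop) : Submodule ℂ (X → ℂ) where
  carrier := {c | ∀ i j, R i j → c i = c j}
  add_mem' hc hd i j h := by simp [hc i j h, hd i j h]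
  zero_mem' i j h := rfl
  smul_mem' a c hc i j h := by simp [hc i j h]

theorem sum_smul_componentProj_apply (hint : DirectSum.IsInternal W) (c : ι → ℂ) {i : ι} {v : V}
    (hv : v ∈ W i) : (∑ j, c j • componentProj hint j) v = c i • v := by
  rw [LinearMap.sum_apply, Finset.sum_eq_single i]
  · rw [LinearMap.smul_apply, componentProj_self hint hv]
  · intro j _ hj
    rw [LinearMap.smul_apply, componentProj_of_ne hint hj.symm hv, smul_zero]
  · simp

/-- Split an element of `𝔭` along `𝔯 + 𝔫`. The part in `𝔯` preserves each `W i`. The part in `𝔫`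
sends `W i` to `W j` with a non-zero component only along an arrow, where `c i = c j`. -/
theorem sum_smul_mem_commutant (hτ : IsLieRep τ) (hlam : Function.Injective lam)
    (hW : ∀ i, IsIrredOfWeight τ (lam i) (W i)) (hint : DirectSum.IsInternal W) {c : ι → ℂ}
    (hc : c ∈ constantAlong fun i j => ArrowNonzero τ (lam i) (lam j)) :
    ∑ j, c j • componentProj hint j ∈ commutant τ := by
  intro x v
  set φ := ∑ j, c j • componentProj hint j with hφ
  suffices h : φ ∘ₗ τ x = τ x ∘ₗ φ from LinearMap.congr_fun h v
  refine linearMap_ext_of_isInternal hint fun i v hv => ?_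
  rw [LinearMap.comp_apply, LinearMap.comp_apply, hφ, sum_smul_componentProj_apply hint c hv,
    map_smul]
  obtain ⟨y, hy, z, hz, hyz⟩ := exists_add_of_mem_parabolic x.2
  let y' : parabolic b S := ⟨y, mem_parabolic_of_mem_levi hy⟩
  let z' : parabolic b S := ⟨z, mem_parabolic_of_mem_nilrad hz⟩
  have hx : x = y' + z' := Subtype.ext hyz
  rw [hx, map_add, LinearMap.add_apply, map_add, smul_add,
    sum_smul_componentProj_apply hint c ((hW i).stable y' hy v hv)]
  congr 1
  rw [LinearMap.sum_apply]
  conv_rhs => rw [← sum_componentProj hint (τ z' v), Finset.smul_sum]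
  refine Finset.sum_congr rfl fun j _ => ?_
  rw [LinearMap.smul_apply]
  by_cases h0 : componentProj hint j (τ z' v) = 0
  · rw [h0, smul_zero, smul_zero]
  · rw [hc i j ((arrowNonzero_iff hτ hlam hW hint).mpr ⟨z', hz, v, hv, h0⟩)]

/-- The endomorphisms of a multiplicity free representation of `𝔭` are given by scalars on the
irreducible components, equal along the arrows. -/
def constantAlongEquivCommutant (hτ : IsLieRep τ) (hlam : Function.Injective lam)
    (hW : ∀ i, IsIrredOfWeight τ (lam i) (W i)) (hint : DirectSum.IsInternal W) :
    constantAlong (fun i j => ArrowNonzero τ (lam i) (lam j)) ≃ₗ[ℂ] commutant τ :=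
  LinearEquiv.ofBijective
    { toFun := fun c => ⟨_, sum_smul_mem_commutant hτ hlam hW hint c.2⟩
      map_add' := fun c d => Subtype.ext (by simp [add_smul, Finset.sum_add_distrib])
      map_smul' := fun a c => Subtype.ext (by simp [mul_smul, Finset.smul_sum]) }
    ⟨by
      rw [injective_iff_map_eq_zero]
      intro c hc
      have hc' : ∑ j, c.1 j • componentProj hint j = 0 := Subtype.ext_iff.mp hc
      ext i
      obtain ⟨w, hwW, hw0, -⟩ := (hW i).exists_highest
      have h1 := sum_smul_componentProj_apply hint c.1 hwW
      rw [hc', LinearMap.zero_apply] at h1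
      exact (smul_eq_zero.mp h1.symm).resolve_right hw0, by
      rintro ⟨φ, hφ⟩
      choose c hc using exists_scalars hτ hlam hW hint (fun x _ v => hφ x v)
      refine ⟨⟨c, ?_⟩, Subtype.ext ?_⟩
      · intro i j hij
        obtain ⟨x, hx, v, hv, h0⟩ := (arrowNonzero_iff hτ hlam hW hint).mp hij
        -- The same component is computed twice: with `φ` applied last it carries `c j`, with `φ`
        -- applied first it carries `c i`.
        have h1 : componentProj hint j (φ (τ x v)) = c j • componentProj hint j (τ x v) := by
          rw [componentProj_comm hint (fun i v hv => ?_), hc j _ (componentProj_mem hint j _)]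
          rw [hc i v hv]
          exact Submodule.smul_mem _ _ hv
        rw [hφ x v, hc i v hv, map_smul, map_smul] at h1
        exact smul_left_injective ℂ h0 h1
      · refine linearMap_ext_of_isInternal hint fun i v hv => ?_
        rw [hc i v hv]
        exact sum_smul_componentProj_apply hint c hv⟩

end MultiplicityFree

end

/-! ### Non-zero components of the action of `𝔫` are arrows of the quiver. -/

section

open LieAlgebra LieAlgebra.IsKilling Module

section InvariantSubmodule

variable {L : Type*} [LieRing L] [LieAlgebra ℂ L] {V : Type*} [AddCommGroup V] [Module ℂ V]
  {σ : L →ₗ[ℂ] End ℂ V}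
  (hσ : ∀ x y, σ ⁅x, y⁆ = σ x * σ y - σ y * σ x)

/-- An invariant subspace of a representation of a Lie algebra, as a Lie module. -/
@[reducible]
def invariantLieRingModule {W : Submodule ℂ V} (hW : ∀ x, ∀ w ∈ W, σ x w ∈ W) :
    LieRingModule L W where
  bracket x w := ⟨σ x w, hW x w w.2⟩
  add_lie x y w := Subtype.ext (by simp)
  lie_add x w w' := Subtype.ext (by simp)
  leibniz_lie x y w := Subtype.ext (by simp [hσ])

theorem invariantLieModule {W : Submodule ℂ V} (hW : ∀ x, ∀ w ∈ W, σ x w ∈ W) :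
    letI := invariantLieRingModule hσ hW
    LieModule ℂ L W :=
  letI := invariantLieRingModule hσ hW
  { smul_lie := fun c x w => Subtype.ext (by
      change σ (c • x) w = c • σ x w
      simp)
    lie_smul := fun c x w => Subtype.ext (by
      change σ x (c • (w : V)) = c • σ x w
      simp) }

theorem isIrreducible_invariant {W : Submodule ℂ V} (hW : ∀ x, ∀ w ∈ W, σ x w ∈ W) (h0 : W ≠ ⊥)
    (hirr : ∀ W' ≤ W, (∀ x, ∀ w ∈ W', σ x w ∈ W') → W' = ⊥ ∨ W' = W) :
    letI := invariantLieRingModule hσ hW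
    letI := invariantLieModule hσ hW
    LieModule.IsIrreducible ℂ L W := by
  let := invariantLieRingModule hσ hW
  let := invariantLieModule hσ hW
  have : Nontrivial W := Submodule.nontrivial_iff_ne_bot.mpr h0
  refine LieModule.IsIrreducible.mk fun N hN => ?_
  have hst : ∀ x, ∀ w ∈ N.toSubmodule.map W.subtype, σ x w ∈ N.toSubmodule.map W.subtype := by
    rintro x _ ⟨w, hw, rfl⟩
    exact ⟨_, N.lie_mem (x := x) hw, rfl⟩
  rw [eq_top_iff]
  intro w _
  rcases hirr _ (Submodule.map_subtype_le W _) hst with h | h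
  · refine absurd ?_ hN
    rw [← LieSubmodule.toSubmodule_eq_bot]
    exact Submodule.map_injective_of_injective W.injective_subtype
      (h.trans (Submodule.map_bot _).symm)
  · obtain ⟨w', hw', hww⟩ := h.ge w.2
    rwa [← Subtype.ext hww]

variable {N : Type*} [AddCommGroup N] [Module ℂ N] [LieRingModule L N] [LieModule ℂ L N]
  {ι : Type*} [DecidableEq ι] {W : ι → Submodule ℂ V}

/-- The component `N → Hom(W i, W j)` of an equivariant map `N → End V`. -/
def homComponent (hint : DirectSum.IsInternal W) (hW : ∀ i x, ∀ w ∈ W i, σ x w ∈ W i)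
    (ν : N →ₗ[ℂ] End ℂ V) (hν : ∀ x n, ν ⁅x, n⁆ = σ x * ν n - ν n * σ x) (i j : ι) :
    letI := invariantLieRingModule hσ (hW i)
    letI := invariantLieModule hσ (hW i)
    letI := invariantLieRingModule hσ (hW j)
    letI := invariantLieModule hσ (hW j)
    N →ₗ⁅ℂ, L⁆ (W i →ₗ[ℂ] W j) :=
  letI := invariantLieRingModule hσ (hW i)
  letI := invariantLieModule hσ (hW i)
  letI := invariantLieRingModule hσ (hW j)
  letI := invariantLieModule hσ (hW j)
  { toFun := fun n => (componentProj hint j ∘ₗ ν n ∘ₗ (W i).subtype).codRestrict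
      (W j) fun _ => componentProj_mem hint j _
    map_add' := fun n n' => by
      ext w
      simp
    map_smul' := fun c n => by
      ext w
      simp
    map_lie' := by
      intro x n
      ext w
      change componentProj hint j (ν ⁅x, n⁆ w) =
        σ x (componentProj hint j (ν n w)) - componentProj hint j (ν n (σ x w))
      rw [hν, ← componentProj_comm hint (fun i v hv => hW i x v hv), LinearMap.sub_apply, map_sub]
      rfl }

/-- The equivariant map `N → Hom(W i, W j)` corresponds, by the tensor-hom adjunction, to one on `N
⊗ W i`; its value on `n ⊗ v` is the given non-zero component. -/
theorem exists_equivariant_ne_zero (hint : DirectSum.IsInternal W)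
    (hW : ∀ i x, ∀ w ∈ W i, σ x w ∈ W i) (ν : N →ₗ[ℂ] End ℂ V)
    (hν : ∀ x n, ν ⁅x, n⁆ = σ x * ν n - ν n * σ x) {i j : ι} {n : N} {v : V} (hv : v ∈ W i)
    (h : componentProj hint j (ν n v) ≠ 0) :
    letI := invariantLieRingModule hσ (hW i)
    letI := invariantLieModule hσ (hW i)
    letI := invariantLieRingModule hσ (hW j)
    letI := invariantLieModule hσ (hW j)
    ∃ f : N ⊗[ℂ] W i →ₗ⁅ℂ, L⁆ W j, f ≠ 0 := by
  let := invariantLieRingModule hσ (hW i)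
  let := invariantLieModule hσ (hW i)
  let := invariantLieRingModule hσ (hW j)
  let := invariantLieModule hσ (hW j)
  refine ⟨TensorProduct.LieModule.liftLie ℂ L N (W i) (W j) (homComponent hσ hint hW ν hν i j),
    fun h0 => h ?_⟩
  have h1 := TensorProduct.LieModule.liftLie_apply ℂ L N (W i) (W j)
    (homComponent hσ hint hW ν hν i j) n ⟨v, hv⟩
  rw [h0] at h1
  exact (congrArg Subtype.val h1).symm

end InvariantSubmodule

section Inclusions

variable {𝔤 : Type*} [LieRing 𝔤] [LieAlgebra ℂ 𝔤] {L : LieSubalgebra ℂ 𝔤} {Q : Submodule ℂ 𝔤}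

/-- The inclusion of a Lie subalgebra in a subspace that contains it. -/
def subalgebraInclusion (h : ∀ {x}, x ∈ L → x ∈ Q) : L →ₗ[ℂ] Q where
  toFun x := ⟨x, h x.2⟩
  map_add' _ _ := rfl
  map_smul' _ _ := rfl

theorem coe_subalgebraInclusion (h : ∀ {x}, x ∈ L → x ∈ Q) (x : L) :
    (subalgebraInclusion h x : 𝔤) = x :=
  rfl

theorem subalgebraInclusion_mk (h : ∀ {x}, x ∈ L → x ∈ Q) (x : Q) (hx : (x : 𝔤) ∈ L) :
    subalgebraInclusion h ⟨x, hx⟩ = x :=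
  rfl

variable {N : LieSubmodule ℂ L 𝔤}

/-- The inclusion of a submodule for a Lie subalgebra in a subspace that contains it. -/
def submoduleInclusion (h : ∀ {x}, x ∈ N → x ∈ Q) : N →ₗ[ℂ] Q where
  toFun x := ⟨x, h x.2⟩
  map_add' _ _ := rfl
  map_smul' _ _ := rfl

theorem coe_submoduleInclusion (h : ∀ {x}, x ∈ N → x ∈ Q) (x : N) :
    (submoduleInclusion h x : 𝔤) = x :=
  rfl

theorem submoduleInclusion_mk (h : ∀ {x}, x ∈ N → x ∈ Q) (x : Q) (hx : (x : 𝔤) ∈ N) :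
    submoduleInclusion h ⟨x, hx⟩ = x :=
  rfl

end Inclusions

section LeviModule

variable {𝔤 : Type*} [LieRing 𝔤] [LieAlgebra ℂ 𝔤] [FiniteDimensional ℂ 𝔤] [IsKilling ℂ 𝔤]
  {H : LieSubalgebra ℂ 𝔤} [H.IsCartanSubalgebra]
  {b : (rootSystem H).Base} {S : Set b.support}
  {V : Type} [AddCommGroup V] [Module ℂ V] {τ : parabolic b S →ₗ[ℂ] End ℂ V}

variable (τ) in
/-- The action of `𝔯` on a representation of `𝔭`. -/
def leviRep : levi b S →ₗ[ℂ] End ℂ V :=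
  τ ∘ₗ subalgebraInclusion mem_parabolic_of_mem_levi

variable (τ) in
/-- The action of `𝔫` on a representation of `𝔭`. -/
def nilradRep : nilrad b S →ₗ[ℂ] End ℂ V :=
  τ ∘ₗ submoduleInclusion mem_parabolic_of_mem_nilrad

variable (τ) in
theorem leviRep_apply (x : levi b S) :
    leviRep τ x = τ (subalgebraInclusion mem_parabolic_of_mem_levi x) :=
  LinearMap.comp_apply _ _ _

variable (τ) in
theorem nilradRep_apply (x : nilrad b S) :
    nilradRep τ x = τ (submoduleInclusion mem_parabolic_of_mem_nilrad x) :=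
  LinearMap.comp_apply _ _ _

theorem leviRep_lie (hτ : IsLieRep τ) (x y : levi b S) :
    leviRep τ ⁅x, y⁆ = leviRep τ x * leviRep τ y - leviRep τ y * leviRep τ x := by
  simp only [leviRep_apply]
  refine hτ _ _ _ ?_
  rw [coe_subalgebraInclusion, coe_subalgebraInclusion, coe_subalgebraInclusion,
    LieSubalgebra.coe_bracket]

theorem nilradRep_lie (hτ : IsLieRep τ) (x : levi b S) (y : nilrad b S) :
    nilradRep τ ⁅x, y⁆ = leviRep τ x * nilradRep τ y - nilradRep τ y * leviRep τ x := by
  simp only [leviRep_apply, nilradRep_apply]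
  refine hτ _ _ _ ?_
  rw [coe_subalgebraInclusion, coe_submoduleInclusion, coe_submoduleInclusion,
    LieSubmodule.coe_bracket, LieSubalgebra.coe_bracket_of_module]

theorem isLeviStable_iff {W : Submodule ℂ V} :
    IsLeviStable τ W ↔ ∀ x, ∀ w ∈ W, leviRep τ x w ∈ W := by
  constructor
  · intro h x w hw
    rw [leviRep_apply]
    exact h _ (by rw [coe_subalgebraInclusion]; exact x.2) w hw
  · intro h x hx w hw
    have h2 := h ⟨x, hx⟩ w hw
    rwa [leviRep_apply, subalgebraInclusion_mk] at h2

theorem isHighestWeightModule [FiniteDimensional ℂ V] (hτ : IsLieRep τ) {lam : Dual ℂ H}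
    {W : Submodule ℂ V} (hW : IsIrredOfWeight τ lam W) :
    letI := invariantLieRingModule (leviRep_lie hτ) (isLeviStable_iff.mp hW.stable)
    letI := invariantLieModule (leviRep_lie hτ) (isLeviStable_iff.mp hW.stable)
    IsHighestWeightModule b S lam W := by
  let := invariantLieRingModule (leviRep_lie hτ) (isLeviStable_iff.mp hW.stable)
  let := invariantLieModule (leviRep_lie hτ) (isLeviStable_iff.mp hW.stable)
  refine ⟨inferInstance, isIrreducible_invariant _ _ hW.ne_bot fun W' h h' =>
    hW.irreducible W' h (isLeviStable_iff.mpr h'), ?_⟩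
  obtain ⟨w, hwW, hw0, hw⟩ := hW.exists_highest
  refine ⟨⟨w, hwW⟩, fun h => hw0 (congrArg Subtype.val h), fun x hx => Subtype.ext ?_,
    fun χ h1 h2 h3 x hx => Subtype.ext ?_⟩
  · have key : ∀ a, (subalgebraInclusion mem_parabolic_of_mem_levi x : 𝔤) = a → ∀ ha : a ∈ H,
        leviRep τ x w = lam ⟨a, ha⟩ • w := by
      rintro _ rfl ha
      rw [leviRep_apply]
      exact hw.1 _ ha
    exact key x (coe_subalgebraInclusion _ x) hx
  · have key : ∀ a, (subalgebraInclusion mem_parabolic_of_mem_levi x : 𝔤) = a →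
        a ∈ rootSpace H (χ : H → ℂ) → leviRep τ x w = 0 := by
      rintro _ rfl ha
      rw [leviRep_apply]
      exact hw.2 χ h1 h2 h3 _ ha
    exact key x (coe_subalgebraInclusion _ x) hx

variable {ι : Type*} [DecidableEq ι] {lam : ι → Dual ℂ H} {W : ι → Submodule ℂ V}

/-- The summands `W i` and `W j` serve as models of the irreducible modules, and the action of `𝔫`
supplies the equivariant map. -/
theorem hasArrow_of_arrowNonzero [Fintype ι] [FiniteDimensional ℂ V] (hτ : IsLieRep τ)
    (hlam : Function.Injective lam) (hW : ∀ i, IsIrredOfWeight τ (lam i) (W i))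
    (hint : DirectSum.IsInternal W) {i j : ι} (h : ArrowNonzero τ (lam i) (lam j)) :
    HasArrow b S (lam i) (lam j) := by
  obtain ⟨x, hx, v, hv, h0⟩ := (arrowNonzero_iff hτ hlam hW hint).mp h
  have hW' := fun i => isLeviStable_iff.mp (hW i).stable
  have h1 : nilradRep τ ⟨x, hx⟩ = τ x := by rw [nilradRep_apply, submoduleInclusion_mk]
  refine ⟨W i, W j, inferInstance, inferInstance,
    invariantLieRingModule (leviRep_lie hτ) (hW' i), invariantLieModule (leviRep_lie hτ) (hW' i),
    inferInstance, inferInstance,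
    invariantLieRingModule (leviRep_lie hτ) (hW' j), invariantLieModule (leviRep_lie hτ) (hW' j),
    isHighestWeightModule hτ (hW i), isHighestWeightModule hτ (hW j),
    exists_equivariant_ne_zero (leviRep_lie hτ) hint hW' (nilradRep τ)
      (nilradRep_lie hτ) (n := ⟨x, hx⟩) hv ?_⟩
  rwa [h1]

end LeviModule

end

/-! ### The derived representation of the parabolic subalgebra. -/

section

open LieAlgebra LieAlgebra.IsKilling Module

section Derivative

variable {d e r : ℕ} {G : Type*} [TopologicalSpace G] [ChartedSpace (Cn d) G] [Group G]
  [LieGroup 𝓘(ℂ, Cn d) ω G] [LieAlgebra.IsSimple ℂ (LieAlg d G)]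
  {H : LieSubalgebra ℂ (LieAlg d G)} [H.IsCartanSubalgebra]
  {b : (rootSystem H).Base} {S : Set b.support}
  {P : Subgroup G} [ChartedSpace (Cn e) P]

/-- This replaces the inverse of the isomorphism from `Lie P` to `𝔭` by any known preimage. -/
theorem lieAct_apply (hP : IsParabolic (e := e) b S P) (ρ : P →* (Cn r →L[ℂ] Cn r))
    {x : parabolic b S} {v : LieAlg e P} (h : inclDeriv (d := d) P v = x) :
    lieAct hP ρ x = (repDeriv ρ v).toLinearMap := by
  have h1 : ((LinearEquiv.ofInjective (inclDeriv (d := d) (e := e) P) hP.immersion).trans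
      (LinearEquiv.ofEq _ _ hP.lieAlgebra)).symm x = v := by
    rw [LinearEquiv.symm_apply_eq]
    exact Subtype.ext h.symm
  rw [← h1]
  rfl

theorem exists_inclDeriv_eq (hP : IsParabolic (e := e) b S P) (x : parabolic b S) :
    ∃ v : LieAlg e P, inclDeriv (d := d) P v = x :=
  hP.lieAlgebra.ge x.2

theorem inclDeriv_mem (hP : IsParabolic (e := e) b S P) (v : LieAlg e P) :
    inclDeriv (d := d) P v ∈ parabolic b S := by
  rw [← hP.lieAlgebra]
  exact ⟨v, rfl⟩

variable [LieGroup 𝓘(ℂ, Cn e) ω P]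

theorem isLieRep_lieAct (hP : IsParabolic (e := e) b S P) {ρ : P →* (Cn r →L[ℂ] Cn r)}
    (hρ : ContMDiff 𝓘(ℂ, Cn e) 𝓘(ℂ, Cn r →L[ℂ] Cn r) ω ρ) : IsLieRep (lieAct hP ρ) := by
  intro x y z hz
  obtain ⟨v, hv⟩ := exists_inclDeriv_eq hP x
  obtain ⟨w, hw⟩ := exists_inclDeriv_eq hP y
  have hvw : inclDeriv (d := d) P ⁅v, w⁆ = z := by
    rw [hz]
    exact mfderiv_groupHom_lie P.subtype hP.holomorphic v w hv.symm hw.symm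
  rw [lieAct_apply hP ρ hv, lieAct_apply hP ρ hw, lieAct_apply hP ρ hvw]
  have h : repDeriv ρ ⁅v, w⁆ = repDeriv ρ v * repDeriv ρ w - repDeriv ρ w * repDeriv ρ v :=
    mfderiv_algebraHom_lie ρ hρ v w rfl rfl
  rw [h]
  rfl

/-- An endomorphism commutes with a holomorphic representation of `P` if and only if it commutes
with the derived representation of `𝔭`. -/
theorem mem_commutant_lieAct_iff (hP : IsParabolic (e := e) b S P) {ρ : P →* (Cn r →L[ℂ] Cn r)}
    (hρ : ContMDiff 𝓘(ℂ, Cn e) 𝓘(ℂ, Cn r →L[ℂ] Cn r) ω ρ) (φ : End ℂ (Cn r)) :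
    φ ∈ commutant (lieAct hP ρ) ↔ ∀ p v, φ (ρ p v) = ρ p (φ v) := by
  have := hP.connected
  let c : Cn r →L[ℂ] Cn r := LinearMap.toContinuousLinearMap φ
  have hc : ∀ L : Cn r →L[ℂ] Cn r, Commute c L ↔ ∀ v, φ (L v) = L (φ v) := fun L =>
    ContinuousLinearMap.ext_iff
  constructor
  · intro h p
    refine (hc _).mp (commute_of_forall_commute_mfderiv ρ hρ c (fun v D hD => ?_) p)
    refine (hc D).mpr fun u => ?_
    have h1 := h ⟨_, inclDeriv_mem hP v⟩ u
    rw [lieAct_apply hP ρ rfl] at h1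
    have hD' : repDeriv ρ v = D := hD
    rw [hD'] at h1
    exact h1
  · intro h x u
    obtain ⟨v, hv⟩ := exists_inclDeriv_eq hP x
    rw [lieAct_apply hP ρ hv]
    exact (hc _).mp (commute_mfderiv_of_forall_commute ρ hρ c (fun p => (hc _).mpr (h p)) v rfl) u

end Derivative

end

/-! ### Connected components of the support, and the theorem. -/

section

open LieAlgebra LieAlgebra.IsKilling Module

section Components

variable {X : Type*} [Quiver X]

theorem eq_of_path_symmetrify {f : X → ℂ} (hf : f ∈ constantAlong fun a b : X => Nonempty (a ⟶ b))
    {a c : Quiver.Symmetrify X} (p : Quiver.Path a c) : f a = f c := by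
  induction p with
  | nil => rfl
  | cons _ h ih =>
    rcases h with h | h
    · exact ih.trans (hf _ _ ⟨h⟩)
    · exact ih.trans (hf _ _ ⟨h⟩).symm

/-- The functions on the vertices of a quiver that are constant along the arrows are the functions
on the set of connected components. -/
def constantAlongEquivComponents :
    (Quiver.WeaklyConnectedComponent X → ℂ) ≃ₗ[ℂ]
      constantAlong fun a b : X => Nonempty (a ⟶ b) where
  toFun f := ⟨fun a => f (Quiver.WeaklyConnectedComponent.mk a), fun a c ⟨h⟩ =>
    congrArg f ((Quiver.WeaklyConnectedComponent.eq a c).mpr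
      ⟨Quiver.Hom.toPath (V := Quiver.Symmetrify X) (Sum.inl h)⟩)⟩
  map_add' _ _ := rfl
  map_smul' _ _ := rfl
  invFun f := Quotient.lift f.1 fun _ _ ⟨p⟩ => eq_of_path_symmetrify f.2 p
  left_inv f := by
    ext a
    obtain ⟨a, rfl⟩ := Quotient.exists_rep a
    rfl
  right_inv f := rfl

/-- Functions constant along a relation are transported by equivalences. -/
def constantAlongCongr {X Y : Type*} (e : X ≃ Y) {R : X → X → Prop} {R' : Y → Y → Prop}
    (h : ∀ a c, R a c ↔ R' (e a) (e c)) : constantAlong R ≃ₗ[ℂ] constantAlong R' where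
  toFun f := ⟨f.1 ∘ e.symm, fun a c hac => f.2 _ _ ((h _ _).mpr (by simpa using hac))⟩
  map_add' _ _ := rfl
  map_smul' _ _ := rfl
  invFun f := ⟨f.1 ∘ e, fun a c hac => f.2 _ _ ((h a c).mp hac)⟩
  left_inv f := by
    ext a
    simp
  right_inv f := by
    ext a
    simp

end Components

section Support

variable {d e r : ℕ} {G : Type*} [TopologicalSpace G] [ChartedSpace (Cn d) G] [Group G]
  [LieGroup 𝓘(ℂ, Cn d) ω G] [LieAlgebra.IsSimple ℂ (LieAlg d G)]
  {H : LieSubalgebra ℂ (LieAlg d G)} [H.IsCartanSubalgebra]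
  {b : (rootSystem H).Base} {S : Set b.support}
  {P : Subgroup G} [ChartedSpace (Cn e) P] [LieGroup 𝓘(ℂ, Cn e) ω P]
  {hP : IsParabolic (e := e) b S P} {ρ : P →* (Cn r →L[ℂ] Cn r)}
  (hρ : ContMDiff 𝓘(ℂ, Cn e) 𝓘(ℂ, Cn r →L[ℂ] Cn r) ω ρ)
  {ι : Type*} [Fintype ι] [DecidableEq ι] {lam : ι → Dual ℂ H} {W : ι → Submodule ℂ (Cn r)}

include hρ in
/-- The vertices of the support of a multiplicity free representation are the highest weights of
its irreducible components. -/
def supportVertexEquiv (hlam : Function.Injective lam)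
    (hW : ∀ i, IsIrredOfWeight (lieAct hP ρ) (lam i) (W i)) (hint : DirectSum.IsInternal W) :
    ι ≃ SupportVertex hP ρ :=
  Equiv.ofBijective
    -- Dominance of `lam i` is witnessed by `ρ` itself.
    (fun i => ⟨⟨lam i, r, ρ, W i, hρ, hW i⟩, multiplicitySpace_ne_bot hW i⟩)
    ⟨fun i j h => hlam (congrArg (fun a : SupportVertex hP ρ => a.1.1) h), fun a => by
      obtain ⟨i, hi⟩ := exists_of_multiplicitySpace_ne_bot (isLieRep_lieAct hP hρ) hW hint a.2
      exact ⟨i, Subtype.ext (Subtype.ext hi)⟩⟩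

/-- An arrow of the support must also be an arrow of the quiver of `G/P`; this second condition
follows from the first. -/
theorem arrowNonzero_iff_nonempty_hom (hlam : Function.Injective lam)
    (hW : ∀ i, IsIrredOfWeight (lieAct hP ρ) (lam i) (W i)) (hint : DirectSum.IsInternal W)
    (i j : ι) : ArrowNonzero (lieAct hP ρ) (lam i) (lam j) ↔
      Nonempty (supportVertexEquiv hρ hlam hW hint i ⟶ supportVertexEquiv hρ hlam hW hint j) :=
  ⟨fun h => ⟨⟨⟨hasArrow_of_arrowNonzero (isLieRep_lieAct hP hρ) hlam hW hint h⟩, h⟩⟩,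
    fun ⟨h⟩ => h.2⟩

end Support

namespace HomogeneousStructure

section Main

variable {d e m r : ℕ} {G : Type*} [TopologicalSpace G] [ChartedSpace (Cn d) G] [Group G]
  [LieGroup 𝓘(ℂ, Cn d) ω G] [LieAlgebra.IsSimple ℂ (LieAlg d G)]
  {H : LieSubalgebra ℂ (LieAlg d G)} [H.IsCartanSubalgebra]
  {b : (rootSystem H).Base} {S : Set b.support}
  {P : Subgroup G} [ChartedSpace (Cn e) P] [LieGroup 𝓘(ℂ, Cn e) ω P]
  (hP : IsParabolic (e := e) b S P)
  [ChartedSpace (Cn m) (G ⧸ P)]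
  {E : G ⧸ P → Type*} [TopologicalSpace (Bundle.TotalSpace (Cn r) E)]
  [∀ x, AddCommGroup (E x)] [∀ x, Module ℂ (E x)] [∀ x, TopologicalSpace (E x)]
  [∀ x, IsTopologicalAddGroup (E x)] [∀ x, ContinuousSMul ℂ (E x)]
  [FiberBundle (Cn r) E] [VectorBundle ℂ (Cn r) E] (A : HomogeneousStructure d m r E)

omit [∀ x, IsTopologicalAddGroup (E x)] [∀ x, ContinuousSMul ℂ (E x)] in
theorem repCommutant_eq : A.repCommutant = commutant (lieAct hP A.rep) := by
  ext φ
  exact (mem_commutant_lieAct_iff hP (A.contMDiff_rep hP.holomorphic) φ).symm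

omit [LieGroup 𝓘(ℂ, Cn d) ω G] [LieAlgebra.IsSimple ℂ (LieAlg d G)]
  [∀ x, IsTopologicalAddGroup (E x)] [∀ x, ContinuousSMul ℂ (E x)] in
theorem exists_eq_smul_id_of_finrank (h : finrank ℂ A.repCommutant = 1) {φ : End ℂ (Cn r)}
    (hφ : φ ∈ A.repCommutant) : ∃ c : ℂ, φ = c • LinearMap.id := by
  let i : A.repCommutant := ⟨LinearMap.id, fun _ _ => rfl⟩
  -- If the identity of `ℂ^r` is zero, then so is `φ`; otherwise the identity spans the line.
  by_cases h0 : i = 0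
  · have h1 : (LinearMap.id : End ℂ (Cn r)) = 0 := congrArg Subtype.val h0
    refine ⟨0, ?_⟩
    rw [zero_smul, ← LinearMap.id_comp φ, h1, LinearMap.zero_comp]
  · obtain ⟨c, hc⟩ := (finrank_eq_one_iff_of_nonzero' i h0).mp h ⟨φ, hφ⟩
    exact ⟨c, (congrArg Subtype.val hc).symm⟩

omit [LieGroup 𝓘(ℂ, Cn d) ω G] [LieAlgebra.IsSimple ℂ (LieAlg d G)] in
/-- An invariant endomorphism that is a scalar on the fibre at the base point is a scalar. -/
theorem apply_eq_smul_of_evalBase {s : A.invariantEnd} {c : ℂ}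
    (hs : (A.evalBase s).1 = c • LinearMap.id) (x : G ⧸ P) (v : E x) : s.1 x v = c • v := by
  have h0 : ∀ v, s.1 ((1 : G) : G ⧸ P) v = c • v := by
    intro v
    have h1 := A.evalBase_apply s v
    rw [hs, LinearMap.smul_apply, LinearMap.id_apply, ← map_smul] at h1
    exact ((fibreEquiv E).injective h1).symm
  obtain ⟨g, rfl⟩ := QuotientGroup.mk_surjective x
  obtain ⟨u, rfl⟩ : ∃ u, A.fibreMap g u = v := ⟨_, A.fibreMap_fibreMapInv g v⟩
  refine (apply_fibreMap A (s := fun x => s.1 x) s.2 g u).trans ?_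
  rw [h0, map_smul]

end Main

end HomogeneousStructure

end

end HomBundle

end

theorem propositionA {d e m r : ℕ}
    -- `G` is a complex simple Lie group of type `ADE`
    {G : Type*} [TopologicalSpace G] [ChartedSpace (HomBundle.Cn d) G] [Group G]
    [LieGroup 𝓘(ℂ, HomBundle.Cn d) ω G] [ConnectedSpace G]
    [LieAlgebra.IsSimple ℂ (HomBundle.LieAlg d G)]
    {H : LieSubalgebra ℂ (HomBundle.LieAlg d G)} [H.IsCartanSubalgebra]
    (b : (LieAlgebra.IsKilling.rootSystem H).Base) (hADE : HomBundle.IsADE b)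
    -- `P = P(S)` is a parabolic subgroup
    (S : Set b.support)
    (P : Subgroup G) [ChartedSpace (HomBundle.Cn e) P] [LieGroup 𝓘(ℂ, HomBundle.Cn e) ω P]
    (hP : HomBundle.IsParabolic (e := e) b S P)
    -- `G ⧸ P` carries the complex structure of the quotient
    [ChartedSpace (HomBundle.Cn m) (G ⧸ P)] [IsManifold 𝓘(ℂ, HomBundle.Cn m) ω (G ⧸ P)]
    (hX : Manifold.IsSubmersion 𝓘(ℂ, HomBundle.Cn d) 𝓘(ℂ, HomBundle.Cn m) ω
      (fun g : G => (g : G ⧸ P)))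
    -- `E` is a holomorphic vector bundle of rank `r` on `G ⧸ P`, homogeneous through `A`
    (E : G ⧸ P → Type*) [TopologicalSpace (Bundle.TotalSpace (HomBundle.Cn r) E)]
    [∀ x, AddCommGroup (E x)] [∀ x, Module ℂ (E x)] [∀ x, TopologicalSpace (E x)]
    [∀ x, IsTopologicalAddGroup (E x)] [∀ x, ContinuousSMul ℂ (E x)]
    [FiberBundle (HomBundle.Cn r) E] [VectorBundle ℂ (HomBundle.Cn r) E]
    [ContMDiffVectorBundle ω (HomBundle.Cn r) E 𝓘(ℂ, HomBundle.Cn m)]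
    (A : HomBundle.HomogeneousStructure d m r E)
    -- `E` is multiplicity free
    (hE : HomBundle.IsMultiplicityFreeRep (HomBundle.lieAct hP A.rep)) :
    Finite (Quiver.WeaklyConnectedComponent (HomBundle.SupportVertex hP A.rep)) ∧
    Nonempty (A.invariantEnd ≃ₗ[ℂ]
      (Fin (Nat.card (Quiver.WeaklyConnectedComponent (HomBundle.SupportVertex hP A.rep))) → ℂ)) ∧
    (Nat.card (Quiver.WeaklyConnectedComponent (HomBundle.SupportVertex hP A.rep)) = 1 →
      A.IsWeaklySimple) := by
  open HomBundle in
  have hρ := A.contMDiff_rep hP.holomorphic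
  obtain ⟨n, lam, W, hlam, hW, hint⟩ := hE
  let vertices := supportVertexEquiv hρ hlam hW hint
  have : Finite (SupportVertex hP A.rep) := .of_equiv _ vertices
  have : Finite (Quiver.WeaklyConnectedComponent (SupportVertex hP A.rep)) :=
    Finite.of_surjective _ Quotient.mk_surjective
  let scalars := (constantAlongCongr vertices
    (arrowNonzero_iff_nonempty_hom hρ hlam hW hint)).trans constantAlongEquivComponents.symm
  -- The chain is: commutant of `P`, commutant of `𝔭`, scalars on the summands equal along arrows,
  -- functions on the components.
  let Φ : A.repCommutant ≃ₗ[ℂ]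
      (Fin (Nat.card (Quiver.WeaklyConnectedComponent (SupportVertex hP A.rep))) → ℂ) :=
    (LinearEquiv.ofEq _ _ (A.repCommutant_eq hP)).trans
      (((constantAlongEquivCommutant (isLieRep_lieAct hP hρ) hlam hW hint).symm.trans
        scalars).trans (LinearEquiv.funCongrLeft ℂ ℂ (Finite.equivFin _).symm))
  refine ⟨this, ⟨(A.invariantEndEquiv hX).trans Φ⟩, fun hcard s hs => ?_⟩
  have hrank : Module.finrank ℂ A.repCommutant = 1 := by
    rw [Φ.finrank_eq, Module.finrank_fin_fun, hcard]
  obtain ⟨c, hc⟩ := A.exists_eq_smul_id_of_finrank hrank (A.evalBase ⟨s, hs⟩).2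
  exact ⟨c, A.apply_eq_smul_of_evalBase hc⟩
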